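/- Let $n\ge 1$. For $\alpha_0,\dots,\alpha_{n-2}\in\mathbb D$ and $\alpha_{n-1}\in S^1$ put $\alpha_{-1}=-1$, $\rho_k=\sqrt{1-|\alpha_k|^2}$, $\Xi_k=\begin{bmatrix}\bar\alpha_k&\rho_k\\ \rho_k&-\alpha_k\end{bmatrix}$ for $0\le k\le n-2$, $\Xi_{-1}=[1]$, $\Xi_{n-1}=[\bar\alpha_{n-1}]$, and let $\mathcal C=\mathcal L\mathcal M$ with $\mathcal L=\operatorname{diag}(\Xi_0,\Xi_2,\dots)$, $\mathcal M=\operatorname{diag}(\Xi_{-1},\Xi_1,\Xi_3,\dots)$ be the associated $n\times n$ CMV matrix. On complex $n\times n$ matrices let $\langle X,Y\rangle=\operatorname{Im}\operatorname{tr}(XY)$, let $\nabla\phi$ be the gradient of a real-valued function $\phi$ with respect to this pairing, let $R=\pi_{\mathfrak l}-\pi_{\mathfrak a}$, where $\pi_{\mathfrak l},\pi_{\mathfrak a}$ are the projections for the splitting into lower triangular matrices with real diagonal and anti-Hermitian matrices, and let $$\{\phi,\psi\}|_B=\tfrac12\langle R(\nabla\phi\, B),\nabla\psi\, B\rangle-\tfrac12\langle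 R(B\nabla\phi),B\nabla\psi\rangle$$ be the Gelfand--Dikij bracket. Let $f$ be a complex polynomial, $\phi(B)=\operatorname{Im}\operatorname{tr} f(B)$ and $F(z)=2\operatorname{Re}[zf'(z)]$. Let $t\mapsto(\alpha_0(t),\dots,\alpha_{n-1}(t))\in\mathbb D^{n-1}\times S^1$, $t\in\mathbb R$, be a solution of the Hamiltonian flow generated by $\phi$: the corresponding CMV matrices $\mathcal C(t)$ satisfy $\frac{d}{dt}\psi(\mathcal C(t))=\{\phi,\psi\}(\mathcal C(t))$ for every differentiable real-valued $\psi$. Let $z_1,\dots,z_n$ be the eigenvalues of $\mathcal C(0)$, let $\mu_j$ be the mass given to $z_j$ by the spectral measure of $\mathcal C(0)$ and the vector $e_1$, put $\lambda_j=F(z_j)$, and suppose that all $\lambda_j$ are distinct, labelled so that $\lambda_1>\lambda_2>\cdots>\lambda_n$. For $1\le k\le n-1$ put $$\xi_{k-1}=(z_k\bar z_{k+1}-1)\frac{\mu_{k+1}}{\mu_k}\prod_{l=1}^{k-1}\left|\frac{z_{k+1}-z_l}{z_k-z_l}\right|^2,\qquad \zeta_{k-1}=(z_{n-k+1}\bar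 z_{n-k}-1)\frac{\mu_{n-k}}{\mu_{n-k+1}}\prod_{l=n-k+2}^{n}\left|\frac{z_{n-k}-z_l}{z_{n-k+1}-z_l}\right|^2 .$$ Then: 1. The eigenvalues of $\mathcal C(t)$ are $z_1,\dots,z_n$ for every $t$. 2. The numbers $\xi_{k-1},\zeta_{k-1}$ are the asymptotic constants of the solution: for each $1\le k\le n-1$ there is $\gamma>\lambda_k-\lambda_{k+1}>0$ with $$\alpha_{k-1}(t)=(-1)^{k-1}\bar z_1\cdots\bar z_k\left[1+\xi_{k-1}e^{-(\lambda_k-\lambda_{k+1})t}+O(e^{-\gamma t})\right]\quad(t\to+\infty),$$ and there is $\gamma>\lambda_{n-k}-\lambda_{n-k+1}>0$ with $$\alpha_{k-1}(t)=(-1)^{k-1}\bar z_n\cdots\bar z_{n-k+1}\left[1+\zeta_{k-1}e^{(\lambda_{n-k}-\lambda_{n-k+1})t}+O(e^{\gamma t})\right]\quad(t\to-\infty).$$ 3. For $1\le k\le n-1$, $$\xi_{k-1}\zeta_{n-k-1}=|z_{k+1}-z_k|^2\prod_{l=1}^{k-1}\left|\frac{z_{k+1}-z_l}{z_k-z_l}\right|^2\prod_{m=k+2}^{n}\left|\frac{z_k-z_m}{z_{k+1}-z_m}\right|^2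 .$$ 4. The limits $\alpha_j(\pm\infty)=\lim_{t\to\pm\infty}\alpha_j(t)$ exist for $-1\le j\le n-1$, and for $1\le k\le n-1$ and every $t\in\mathbb R$ $$\alpha_{k-1}(+\infty)\,\alpha_{n-k-1}(-\infty)=(-1)^n\bar z_1\cdots\bar z_n=(-1)^n\det(\mathcal C(t)^\dagger)=-\alpha_{n-1}(t),$$ which is independent of $t$. 5. For $1\le j\le n$ (the denominators being non-zero) $$z_j=-\frac{\alpha_{j-2}(+\infty)}{\alpha_{j-1}(+\infty)}=-\frac{\alpha_{n-j-1}(-\infty)}{\alpha_{n-j}(-\infty)} .$$ -/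

import Mathlib

open scoped ComplexConjugate Matrix Topology

namespace CMV

/-- Admissible Verblunsky coefficients `α 0, …, α (n-1)`: the first `n - 1` lie in the open unit
disk and the last one on the unit circle (values `α j` with `j ≥ n` play no role). -/
def IsVerblunsky (n : ℕ) (α : ℕ → ℂ) : Prop :=
  (∀ j, j + 1 < n → ‖α j‖ < 1) ∧ ‖α (n - 1)‖ = 1

/-- The Verblunsky coefficients with the index shifted by one, so as to include the customary
convention `α_{-1} = -1`: `shifted α m` is `α_{m-1}`. -/
def shifted (α : ℕ → ℂ) : ℕ → ℂ
  | 0 => -1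
  | m + 1 => α m

/-- `ρ_k = √(1 - |α_k|²)`. -/
noncomputable def rho (α : ℕ → ℂ) (k : ℕ) : ℝ := Real.sqrt (1 - ‖α k‖ ^ 2)

/-- The `n × n` block-diagonal matrix whose blocks are `Ξ_k = [[conj α_k, ρ_k], [ρ_k, -α_k]]` in
rows and columns `k, k + 1` (counted from `0`), for all `k ≤ n - 2` with `k ≡ p` mod 2, together
with the `1 × 1` blocks `Ξ_{n-1} = [conj α_{n-1}]` in position `n - 1` (if `n - 1 ≡ p`) and
`Ξ_{-1} = [1] = [-α_{-1}]` in position `0` (if `p` is odd). -/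
noncomputable def blockDiag (n : ℕ) (α : ℕ → ℂ) (p : ℕ) : Matrix (Fin n) (Fin n) ℂ :=
  Matrix.of fun i j =>
    if i = j then
      if (i : ℕ) % 2 = p % 2 then conj (α i) else -shifted α i
    else if (j : ℕ) = i + 1 ∧ (i : ℕ) % 2 = p % 2 then (rho α i : ℂ)
    else if (i : ℕ) = j + 1 ∧ (j : ℕ) % 2 = p % 2 then (rho α j : ℂ)
    else 0

/-- The CMV matrix `𝓛 𝓜`, `𝓛 = diag(Ξ_0, Ξ_2, …)`, `𝓜 = diag(Ξ_{-1}, Ξ_1, Ξ_3, …)`. -/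
noncomputable def cmv (n : ℕ) (α : ℕ → ℂ) : Matrix (Fin n) (Fin n) ℂ :=
  blockDiag n α 0 * blockDiag n α 1

/-- Projection of complex matrices onto the anti-Hermitian ones along the lower triangular
matrices with real diagonal. -/
noncomputable def projA {n : ℕ} (X : Matrix (Fin n) (Fin n) ℂ) : Matrix (Fin n) (Fin n) ℂ :=
  Matrix.of fun i j =>
    if i < j then X i j
    else if i = j then Complex.I * ((X i i).im : ℂ)
    else -conj (X j i)

/-- The complementary projection onto the lower triangular matrices with real diagonal. -/
noncomputable def projL {n : ℕ} (X : Matrix (Fin n) (Fin n) ℂ) : Matrix (Fin n) (Fin n) ℂ :=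
  X - projA X

/-- The `R`-matrix `R = π_l - π_a`. -/
noncomputable def R {n : ℕ} (X : Matrix (Fin n) (Fin n) ℂ) : Matrix (Fin n) (Fin n) ℂ :=
  projL X - projA X

/-- The pairing `⟨X, Y⟩ = Im tr (X Y)`. -/
noncomputable def pairing {n : ℕ} (X Y : Matrix (Fin n) (Fin n) ℂ) : ℝ :=
  (X * Y).trace.im

/-- The gradient of `φ` with respect to `pairing`: its `(k, l)` entry is
`∂φ/∂v_{l,k} + i ∂φ/∂u_{l,k}`, where `u + i v` are the matrix entries. -/
noncomputable def grad {n : ℕ} (φ : Matrix (Fin n) (Fin n) ℂ → ℝ)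
    (B : Matrix (Fin n) (Fin n) ℂ) : Matrix (Fin n) (Fin n) ℂ :=
  Matrix.of fun k l =>
    ((lineDeriv ℝ φ B (Matrix.single l k Complex.I) : ℝ) : ℂ)
      + Complex.I * ((lineDeriv ℝ φ B (Matrix.single l k 1) : ℝ) : ℂ)

/-- The Gelfand–Dikij (quadratic, Sklyanin) Poisson bracket on the space of matrices. -/
noncomputable def bracket {n : ℕ} (φ ψ : Matrix (Fin n) (Fin n) ℂ → ℝ)
    (B : Matrix (Fin n) (Fin n) ℂ) : ℝ :=
  1 / 2 * pairing (R (grad φ B * B)) (grad ψ B * B)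
    - 1 / 2 * pairing (R (B * grad φ B)) (B * grad ψ B)

/-- `B` is an integral curve, defined for all times, of the Hamiltonian flow generated by `φ`:
`d/dt ψ(B(t)) = {φ, ψ}(B(t))` for every differentiable function `ψ` on the space of matrices. -/
def IsFlow {n : ℕ} (φ : Matrix (Fin n) (Fin n) ℂ → ℝ)
    (B : ℝ → Matrix (Fin n) (Fin n) ℂ) : Prop :=
  ∀ ψ : Matrix (Fin n) (Fin n) ℂ → ℝ, Differentiable ℝ ψ →
    ∀ t : ℝ, HasDerivAt (fun s => ψ (B s)) (bracket φ ψ (B t)) t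

/-- The Ablowitz–Ladik Hamiltonian `φ(B) = Im tr f(B)`. -/
noncomputable def hamiltonian (n : ℕ) (f : Polynomial ℂ) (B : Matrix (Fin n) (Fin n) ℂ) : ℝ :=
  (Polynomial.aeval B f).trace.im

/-- `F(z) = 2 Re (z f'(z))`. -/
noncomputable def speed (f : Polynomial ℂ) (z : ℂ) : ℝ :=
  2 * (z * f.derivative.eval z).re

/-- The first standard basis vector `e₁`. -/
noncomputable def e1 (n : ℕ) : EuclideanSpace ℂ (Fin n) :=
  WithLp.toLp 2 fun i => if (i : ℕ) = 0 then 1 else 0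

/-- The mass which the spectral measure of the unitary matrix `C` and the vector `e₁` gives to the
point `w`: the squared length of the orthogonal projection of `e₁` to `ker (C - w)`. -/
noncomputable def spectralMass {n : ℕ} (C : Matrix (Fin n) (Fin n) ℂ) (w : ℂ) : ℝ :=
  ‖(Module.End.eigenspace (Matrix.toEuclideanLin C) w).starProjection (e1 n)‖ ^ 2

/-- The constant `ξ_{k-1}`, `1 ≤ k ≤ n - 1`. -/
noncomputable def xi (z : ℕ → ℂ) (μ : ℕ → ℝ) (k : ℕ) : ℂ :=
  (z k * conj (z (k + 1)) - 1) * ((μ (k + 1) / μ k : ℝ) : ℂ)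
    * ((∏ l ∈ Finset.Icc 1 (k - 1), ‖(z (k + 1) - z l) / (z k - z l)‖ ^ 2 : ℝ) : ℂ)

/-- The constant `ζ_{k-1}`, `1 ≤ k ≤ n - 1`. -/
noncomputable def zeta (n : ℕ) (z : ℕ → ℂ) (μ : ℕ → ℝ) (k : ℕ) : ℂ :=
  (z (n - k + 1) * conj (z (n - k)) - 1) * ((μ (n - k) / μ (n - k + 1) : ℝ) : ℂ)
    * ((∏ l ∈ Finset.Icc (n - k + 2) n,
          ‖(z (n - k) - z l) / (z (n - k + 1) - z l)‖ ^ 2 : ℝ) : ℂ)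

end CMV

/-!
The Gelfand–Dikij flow of `Im tr f` has the Lax form `C' = [A, C]` with the anti-Hermitian
`A = projA (C f'(C))`. Hence the spectrum is constant, and the `(0, 0)` entries of the spectral
projections show that the mass of `z_j` is proportional to `μ_j e^{λ_j t}`.

The leading `k × k` corner of a CMV matrix is the CMV matrix of `α_0, …, α_{k-1}`, and its
determinant is `(-1)^{k-1} conj α_{k-1}`. Its expansion in an eigenbasis by the Cauchy–Binet formula
involves the `k × k` minors of the eigenvectors; up to unimodular factors, the components of an
eigenvector are polynomials in the eigenvalue times its first component, so these minors are
Vandermonde determinants up to a common constant. This is Heine's formula: up to sign `α_{k-1}` is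
the mean of `∏_{j ∈ S} conj z_j` over the `k`-element sets `S`, with weights proportional to
`∏_{j ∈ S} μ_j e^{λ_j t} ∏_{i < j ∈ S} |z_i - z_j|²`. As `t → ±∞` the mean concentrates on the `k`
largest or smallest `λ_j`, and exchanging the two values of `λ` next to the cut gives the leading
correction.
-/

namespace CMV

section TiltedMean

open Finset Filter Asymptotics

variable {σ E : Type*} [NormedAddCommGroup E] [NormedSpace ℝ E]

/-- The center of mass of the points `b s`, `s ∈ I`, with the exponentially varying masses
`w s * exp (Λ s * t)`. -/
noncomputable def tiltedMean (I : Finset σ) (w Λ : σ → ℝ) (b : σ → E) (t : ℝ) : E :=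
  I.centerMass (fun s => w s * Real.exp (Λ s * t)) b

variable {I : Finset σ} {w Λ : σ → ℝ} {b : σ → E} {s₀ s₁ : σ}

theorem tiltedMean_eq_centerMass_div (h₀ : w s₀ ≠ 0) (t : ℝ) :
    tiltedMean I w Λ b t =
      I.centerMass (fun s => w s / w s₀ * Real.exp (-(Λ s₀ - Λ s) * t)) b := by
  rw [tiltedMean, ← centerMass_smul_left (c := (w s₀ * Real.exp (Λ s₀ * t))⁻¹)
    (hc := inv_ne_zero (mul_ne_zero h₀ (Real.exp_ne_zero _)))]
  congr 1 with s
  rw [Pi.smul_apply, smul_eq_mul, neg_sub, sub_mul, Real.exp_sub]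
  field_simp

theorem tendsto_tiltedMean (h₀ : s₀ ∈ I) (hw₀ : w s₀ ≠ 0)
    (hmax : ∀ s ∈ I, s ≠ s₀ → Λ s < Λ s₀) :
    Tendsto (tiltedMean I w Λ b) atTop (𝓝 (b s₀)) := by
  classical
  have hmass : ∀ s ∈ I, Tendsto (fun t => w s / w s₀ * Real.exp (-(Λ s₀ - Λ s) * t)) atTop
      (𝓝 (if s = s₀ then 1 else 0)) := by
    intro s hs
    split_ifs with h
    · simp [h, hw₀]
    · rw [← mul_zero (w s / w s₀)]
      exact (Real.tendsto_exp_atBot.comp (tendsto_id.const_mul_atTop_of_neg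
        (neg_neg_of_pos (sub_pos.2 (hmax s hs h))))).const_mul _
  have hden := tendsto_finsetSum I hmass
  have hnum := tendsto_finsetSum I fun s hs => (hmass s hs).smul_const (b s)
  simp only [ite_smul, one_smul, zero_smul, sum_ite_eq', h₀, if_true] at hden hnum
  have hmean := (hden.inv₀ one_ne_zero).smul hnum
  rw [inv_one, one_smul] at hmean
  exact hmean.congr fun t => (tiltedMean_eq_centerMass_div hw₀ t).symm

theorem isBigO_exp_neg_mul {r γ : ℝ} (h : γ ≤ r) :
    (fun t => Real.exp (-r * t)) =O[atTop] fun t => Real.exp (-γ * t) := by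
  refine IsBigO.of_bound' ?_
  filter_upwards [eventually_ge_atTop 0] with t ht
  rw [Real.norm_eq_abs, Real.norm_eq_abs, Real.abs_exp, Real.abs_exp]
  gcongr

theorem isBigO_sum_exp_smul {K : Finset σ} {v r : σ → ℝ} {c : σ → E} {γ : ℝ}
    (hr : ∀ s ∈ K, γ ≤ r s) :
    (fun t => ∑ s ∈ K, (v s * Real.exp (-r s * t)) • c s) =O[atTop]
      fun t => Real.exp (-γ * t) := by
  refine IsBigO.fun_sum fun s hs => IsBigO.trans ?_ (isBigO_exp_neg_mul (hr s hs))
  refine isBigO_of_le' (c := |v s| * ‖c s‖) _ fun t => ?_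
  rw [norm_smul, norm_mul, Real.norm_eq_abs (v s), mul_right_comm]

theorem exists_rate_between {K : Finset σ} {r : σ → ℝ} {δ : ℝ} (hδ : 0 < δ)
    (hr : ∀ s ∈ K, δ < r s) : ∃ γ, δ < γ ∧ γ < 2 * δ ∧ ∀ s ∈ K, γ < r s := by
  have hev : ∀ᶠ γ in 𝓝[>] δ, δ < γ ∧ γ < 2 * δ ∧ ∀ s ∈ K, γ < r s :=
    eventually_mem_nhdsWithin.and
      (((eventually_lt_nhds (by linarith)).filter_mono nhdsWithin_le_nhds).and
        ((eventually_all_finset K).2 fun s hs =>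
          (eventually_lt_nhds (hr s hs)).filter_mono nhdsWithin_le_nhds))
  exact hev.exists

theorem centerMass_sub_eq [DecidableEq σ] {v : σ → ℝ} (h₀ : s₀ ∈ I) (hv₀ : v s₀ = 1)
    (hsum : ∑ s ∈ I, v s ≠ 0) :
    I.centerMass v b - b s₀ = ∑ s ∈ I.erase s₀, v s • (b s - b s₀)
      - (∑ s ∈ I.erase s₀, v s) • (I.centerMass v b - b s₀) := by
  have hmoment : (∑ s ∈ I, v s) • (I.centerMass v b - b s₀) = ∑ s ∈ I, v s • (b s - b s₀) := by
    simp only [centerMass, smul_sub, smul_inv_smul₀ hsum, sum_sub_distrib, sum_smul]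
  rw [← add_sum_erase _ _ h₀, ← add_sum_erase _ _ h₀, hv₀, add_smul, one_smul, sub_self,
    smul_zero, zero_add] at hmoment
  exact eq_sub_of_add_eq hmoment

theorem tiltedMean_sub_eq [DecidableEq σ] (hw : ∀ s ∈ I, 0 < w s) (h₀ : s₀ ∈ I) (t : ℝ) :
    tiltedMean I w Λ b t - b s₀ =
      ∑ s ∈ I.erase s₀, (w s / w s₀ * Real.exp (-(Λ s₀ - Λ s) * t)) • (b s - b s₀)
      - (∑ s ∈ I.erase s₀, w s / w s₀ * Real.exp (-(Λ s₀ - Λ s) * t))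
        • (tiltedMean I w Λ b t - b s₀) := by
  rw [tiltedMean_eq_centerMass_div (hw s₀ h₀).ne']
  refine centerMass_sub_eq h₀ (by simp [(hw s₀ h₀).ne']) (sum_pos (fun s hs => ?_) ⟨s₀, h₀⟩).ne'
  exact mul_pos (div_pos (hw s hs) (hw s₀ h₀)) (Real.exp_pos _)

theorem isBigO_tiltedMean_sub [DecidableEq σ] {δ : ℝ} (hw : ∀ s ∈ I, 0 < w s) (h₀ : s₀ ∈ I)
    (hδ : ∀ s ∈ I.erase s₀, δ ≤ Λ s₀ - Λ s) :
    (fun t => tiltedMean I w Λ b t - b s₀) =O[atTop] fun t => Real.exp (-δ * t) := by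
  refine IsBigO.trans (isBigO_of_le _ fun t => ?_)
    (isBigO_sum_exp_smul (v := fun s => w s / w s₀) (c := fun s => b s - b s₀) hδ)
  rw [← add_eq_of_eq_sub (tiltedMean_sub_eq hw h₀ t)]
  nth_rw 2 [← one_smul ℝ (_ - b s₀)]
  rw [← add_smul, norm_smul, Real.norm_eq_abs]
  refine le_mul_of_one_le_left (norm_nonneg _) (le_trans ?_ (le_abs_self _))
  exact le_add_of_nonneg_right (sum_nonneg fun s hs =>
    mul_nonneg (div_pos (hw s (mem_of_mem_erase hs)) (hw s₀ h₀)).le (Real.exp_pos _).le)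

theorem tiltedMean_asymptotics [DecidableEq σ] (hw : ∀ s ∈ I, 0 < w s) (h₀ : s₀ ∈ I)
    (h₁ : s₁ ∈ I) (hlt : Λ s₁ < Λ s₀) (hrest : ∀ s ∈ (I.erase s₀).erase s₁, Λ s < Λ s₁) :
    ∃ γ, Λ s₀ - Λ s₁ < γ ∧
      (fun t => tiltedMean I w Λ b t -
        (b s₀ + (w s₁ / w s₀ * Real.exp (-(Λ s₀ - Λ s₁) * t)) • (b s₁ - b s₀))) =O[atTop]
      fun t => Real.exp (-γ * t) := by
  obtain ⟨γ, hγ, hγ2, hγrest⟩ := exists_rate_between (r := fun s => Λ s₀ - Λ s) (sub_pos.2 hlt)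
    fun s hs => sub_lt_sub_left (hrest s hs) (Λ s₀)
  have h₁' : s₁ ∈ I.erase s₀ := mem_erase.2 ⟨fun h => hlt.ne (congrArg Λ h), h₁⟩
  have hδ : ∀ s ∈ I.erase s₀, Λ s₀ - Λ s₁ ≤ Λ s₀ - Λ s := by
    intro s hs
    rcases eq_or_ne s s₁ with rfl | hne
    · rfl
    · exact sub_le_sub_left (hrest s (mem_erase.2 ⟨hne, hs⟩)).le _
  have htail : (fun t => ∑ s ∈ I.erase s₀, (w s / w s₀ * Real.exp (-(Λ s₀ - Λ s) * t)))
      =O[atTop] fun t => Real.exp (-(Λ s₀ - Λ s₁) * t) := by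
    simpa only [smul_eq_mul, mul_one] using
      isBigO_sum_exp_smul (v := fun s => w s / w s₀) (c := fun _ => (1 : ℝ)) hδ
  have hproduct := htail.smul (isBigO_tiltedMean_sub (b := b) hw h₀ hδ)
  simp only [smul_eq_mul, ← Real.exp_add, ← two_mul, ← mul_assoc, mul_neg] at hproduct
  replace hproduct := hproduct.trans (isBigO_exp_neg_mul hγ2.le)
  have hremaining := isBigO_sum_exp_smul (v := fun s => w s / w s₀) (c := fun s => b s - b s₀)
    fun s hs => (hγrest s hs).le
  refine ⟨γ, hγ, (hremaining.sub hproduct).congr_left fun t => ?_⟩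
  rw [← sub_sub, eq_sub_iff_add_eq, sub_add_eq_add_sub, sum_erase_add _ _ h₁']
  exact (tiltedMean_sub_eq hw h₀ t).symm

end TiltedMean

section AsymptoticConstant

variable {ι : Type*} {z : ι → ℂ} {μ : ι → ℝ}

/-- The coefficient of the leading exponential correction when the dominant set is `insert a P`
and the runner-up is `insert b P`; it specializes to both `xi` and `zeta`. -/
noncomputable def asymptoticConstant (z : ι → ℂ) (μ : ι → ℝ) (P : Finset ι) (a b : ι) : ℂ :=
  (z a * conj (z b) - 1) * ((μ b / μ a : ℝ) : ℂ)
    * ((∏ l ∈ P, ‖(z b - z l) / (z a - z l)‖ ^ 2 : ℝ) : ℂ)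

theorem asymptoticConstant_mul_swap {a b : ι} (ha : ‖z a‖ = 1) (hμa : μ a ≠ 0) (hμb : μ b ≠ 0)
    (P Q : Finset ι) :
    asymptoticConstant z μ P a b * asymptoticConstant z μ Q b a =
      ((‖z b - z a‖ ^ 2 * (∏ l ∈ P, ‖(z b - z l) / (z a - z l)‖ ^ 2)
        * ∏ l ∈ Q, ‖(z a - z l) / (z b - z l)‖ ^ 2 : ℝ) : ℂ) := by
  have hza : z a * conj (z a) = 1 := by rw [Complex.mul_conj', ha]; simp
  have hdist : ((‖z b - z a‖ ^ 2 : ℝ) : ℂ) =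
      (z a * conj (z b) - 1) * (z b * conj (z a) - 1) := by
    rw [Complex.ofReal_pow, ← Complex.mul_conj', map_sub]
    linear_combination (1 - z b * conj (z b)) * hza
  have hmass : ((μ b / μ a : ℝ) : ℂ) * ((μ a / μ b : ℝ) : ℂ) = 1 := by
    rw [← Complex.ofReal_mul, div_mul_div_cancel₀ hμa, div_self hμb, Complex.ofReal_one]
  rw [Complex.ofReal_mul, Complex.ofReal_mul, hdist, asymptoticConstant, asymptoticConstant,
    mul_mul_mul_comm, mul_mul_mul_comm (_ - 1), hmass, mul_one, ← mul_assoc]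

end AsymptoticConstant

section HeineMean

open Finset Filter Asymptotics

variable {ι : Type*} [DecidableEq ι] {s S P : Finset ι} {z : ι → ℂ} {μ lam : ι → ℝ}

theorem sum_add_lt_sum_of_card_eq {f : ι → ℝ} {S T : Finset ι} {δ : ℝ} (hcard : #S = #T)
    (hne : S ≠ T) (hδ : 0 ≤ δ) (hlt : ∀ x ∈ T \ S, ∀ y ∈ S \ T, f y + δ < f x) :
    ∑ y ∈ S, f y + δ < ∑ x ∈ T, f x := by
  have hcard' : #(S \ T) = #(T \ S) := card_sdiff_comm hcard
  have hpos : 0 < #(S \ T) :=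
    card_pos.2 (sdiff_nonempty.2 fun h => hne (eq_of_subset_of_card_le h hcard.ge))
  obtain ⟨x₀, hx₀, hmin⟩ := exists_min_image (T \ S) f (card_pos.1 (hcard' ▸ hpos))
  obtain ⟨y₀, hy₀, hmax⟩ := exists_max_image (S \ T) f (card_pos.1 hpos)
  have hS : ∑ y ∈ S \ T, f y ≤ #(S \ T) * f y₀ := by
    simpa [nsmul_eq_mul] using sum_le_card_nsmul _ f _ hmax
  have hT : #(S \ T) * f x₀ ≤ ∑ x ∈ T \ S, f x := by
    simpa [nsmul_eq_mul, hcard'] using card_nsmul_le_sum _ f _ hmin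
  have hone : (1 : ℝ) ≤ #(S \ T) := mod_cast hpos
  have := hlt x₀ hx₀ y₀ hy₀
  linarith [sum_sdiff_sub_sum_sdiff (s₁ := S) (s₂ := T) (f := f),
    mul_le_mul_of_nonneg_left this.le (Nat.cast_nonneg (α := ℝ) #(S \ T)),
    le_mul_of_one_le_left hδ hone, mul_lt_mul_of_pos_left this (Nat.cast_pos.2 hpos)]

/-- The weight `∏_{a ∈ S} μ_a · ∏_{a ≠ b ∈ S} |z_b - z_a|` of a set `S` of nodes in Heine's formula;
every unordered pair of nodes contributes the square of its distance. -/
noncomputable def heineWeight (z : ι → ℂ) (μ : ι → ℝ) (S : Finset ι) : ℝ :=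
  ∏ a ∈ S, (μ a * ∏ b ∈ S.erase a, ‖z b - z a‖)

/-- The mean of `∏_{j ∈ S} conj z_j` over the `k`-element sets `S ⊆ s` of nodes, weighted by
`heineWeight`. Up to sign this is the Verblunsky coefficient `α_{k-1}` of the measure with the mass
`μ_j` at `z_j`, `j ∈ s`. -/
noncomputable def heineMean (s : Finset ι) (z : ι → ℂ) (μ : ι → ℝ) (k : ℕ) : ℂ :=
  (s.powersetCard k).centerMass (heineWeight z μ) fun S => ∏ j ∈ S, conj (z j)

theorem heineWeight_insert {a : ι} (ha : a ∉ S) :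
    heineWeight z μ (insert a S) = heineWeight z μ S * (μ a * ∏ l ∈ S, ‖z a - z l‖ ^ 2) := by
  have herase : ∀ l ∈ S, ∏ b ∈ (insert a S).erase l, ‖z b - z l‖ =
      ‖z a - z l‖ * ∏ b ∈ S.erase l, ‖z b - z l‖ := by
    intro l hl
    rw [erase_insert_of_ne (ne_of_mem_of_not_mem hl ha).symm,
      prod_insert fun h => ha (mem_of_mem_erase h)]
  rw [heineWeight, prod_insert ha, erase_insert ha,
    prod_congr rfl fun l hl => congrArg (μ l * ·) (herase l hl)]
  simp only [heineWeight, prod_mul_distrib, sq, norm_sub_rev (z a)]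
  ring

theorem heineWeight_pos (hμ : ∀ a ∈ S, 0 < μ a) (hz : Set.InjOn z S) : 0 < heineWeight z μ S :=
  prod_pos fun a ha => mul_pos (hμ a ha) <| prod_pos fun _ hb =>
    norm_pos_iff.2 (sub_ne_zero.2 (hz.ne (mem_of_mem_erase hb) ha (ne_of_mem_erase hb)))

theorem heineWeight_insert_div_insert {a b : ι} (ha : a ∉ S) (hb : b ∉ S)
    (hS : heineWeight z μ S ≠ 0) :
    heineWeight z μ (insert b S) / heineWeight z μ (insert a S) =
      μ b / μ a * ∏ l ∈ S, ‖(z b - z l) / (z a - z l)‖ ^ 2 := by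
  rw [heineWeight_insert ha, heineWeight_insert hb, mul_div_mul_left _ _ hS, mul_div_mul_comm,
    ← prod_div_distrib]
  simp only [norm_div, div_pow]

theorem heineWeight_mul {c : ι → ℝ} :
    heineWeight z (fun j => c j * μ j) S = (∏ j ∈ S, c j) * heineWeight z μ S := by
  simp only [heineWeight, mul_assoc, prod_mul_distrib]

theorem heineMean_const_mul {c : ℝ} (hc : c ≠ 0) (k : ℕ) :
    heineMean s z (fun j => c * μ j) k = heineMean s z μ k := by
  rw [heineMean, heineMean,
    ← centerMass_smul_left (w := heineWeight z μ) (hc := pow_ne_zero k hc)]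
  exact centerMass_congr_weights fun S hS => by
    rw [heineWeight_mul, prod_const, (mem_powersetCard.1 hS).2, Pi.smul_apply, smul_eq_mul]

theorem heineMean_congr {ν : ι → ℝ} (h : ∀ j ∈ s, μ j = ν j) (k : ℕ) :
    heineMean s z μ k = heineMean s z ν k :=
  centerMass_congr_weights fun _ hS => prod_congr rfl fun j hj => by
    rw [h j ((mem_powersetCard.1 hS).1 hj)]

theorem heineMean_map {κ : Type*} [DecidableEq κ] (e : ι ↪ κ) (s : Finset ι) (z : κ → ℂ)
    (μ : κ → ℝ) (k : ℕ) :
    heineMean (s.map e) z μ k = heineMean s (z ∘ e) (μ ∘ e) k := by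
  have hweight (S : Finset ι) : heineWeight z μ (S.map e) = heineWeight (z ∘ e) (μ ∘ e) S := by
    simp only [heineWeight, prod_map, ← map_erase, Function.comp_apply]
  simp only [heineMean, centerMass, powersetCard_map, sum_map, mapEmbedding_apply,
    RelEmbedding.coe_toEmbedding, hweight, prod_map,
    Function.comp_apply]

theorem heineMean_mul_exp (k : ℕ) :
    (fun t => heineMean s z (fun j => μ j * Real.exp (lam j * t)) k) =
      tiltedMean (s.powersetCard k) (heineWeight z μ) (fun S => ∑ j ∈ S, lam j)
        fun S => ∏ j ∈ S, conj (z j) := by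
  funext t
  rw [heineMean, tiltedMean]
  congr 1 with S
  simp_rw [mul_comm (μ _), heineWeight_mul, ← Real.exp_sum, ← sum_mul, mul_comm]

theorem tendsto_heineMean_atTop (hS : S ⊆ s) (hμ : ∀ a ∈ S, 0 < μ a) (hz : Set.InjOn z S)
    (hlam : ∀ x ∈ S, ∀ y ∈ s \ S, lam y < lam x) :
    Tendsto (fun t => heineMean s z (fun j => μ j * Real.exp (lam j * t)) #S) atTop
      (𝓝 (∏ j ∈ S, conj (z j))) := by
  rw [heineMean_mul_exp]
  refine tendsto_tiltedMean (b := fun S => ∏ j ∈ S, conj (z j))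
    (mem_powersetCard.2 ⟨hS, rfl⟩) (heineWeight_pos hμ hz).ne' fun T hT hne => ?_
  obtain ⟨hTs, hTcard⟩ := mem_powersetCard.1 hT
  simpa using sum_add_lt_sum_of_card_eq hTcard hne le_rfl fun x hx y hy => by
    simpa using hlam x (Finset.mem_sdiff.1 hx).1 y (sdiff_subset_sdiff hTs le_rfl hy)

theorem tendsto_heineMean_atBot (hS : S ⊆ s) (hμ : ∀ a ∈ S, 0 < μ a) (hz : Set.InjOn z S)
    (hlam : ∀ x ∈ S, ∀ y ∈ s \ S, lam x < lam y) :
    Tendsto (fun t => heineMean s z (fun j => μ j * Real.exp (lam j * t)) #S) atBot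
      (𝓝 (∏ j ∈ S, conj (z j))) := by
  simpa only [Function.comp_def, neg_mul_neg] using
    (tendsto_heineMean_atTop (lam := fun j => -lam j) hS hμ hz
      fun x hx y hy => neg_lt_neg (hlam x hx y hy)).comp tendsto_neg_atBot_atTop

theorem heineMean_card (hμ : ∀ a ∈ s, 0 < μ a) (hz : Set.InjOn z s) :
    heineMean s z μ #s = ∏ j ∈ s, conj (z j) := by
  rw [heineMean, powersetCard_self, centerMass_singleton _ _ (heineWeight_pos hμ hz).ne']

theorem sum_lt_sum_insert_of_dominated {T : Finset ι} {a b : ι} (hb : b ∉ P)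
    (hab : lam b < lam a) (hP : ∀ x ∈ P, lam a < lam x)
    (hT : ∀ y ∈ T, y ∉ P → y ≠ a → y ≠ b → lam y < lam b) (hcard : #T = #P + 1)
    (hTa : T ≠ insert a P) (hTb : T ≠ insert b P) :
    ∑ j ∈ T, lam j < ∑ j ∈ insert b P, lam j := by
  by_cases haT : a ∈ T
  · have hsum := sum_add_lt_sum_of_card_eq (S := T.erase a) (T := P) (f := lam)
      (δ := lam a - lam b) (by simp [haT, hcard])
      (fun h => hTa (by rw [← h, insert_erase haT])) (sub_nonneg.2 hab.le) fun x hx y hy => by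
        have hy' : lam y ≤ lam b := by
          simp only [Finset.mem_sdiff, mem_erase] at hy
          rcases eq_or_ne y b with rfl | hyb
          · rfl
          · exact (hT y hy.1.2 hy.2 hy.1.1 hyb).le
        linarith [hP x (Finset.mem_sdiff.1 hx).1]
    rw [sum_insert hb, ← add_sum_erase _ _ haT]
    linarith
  · have hsum := sum_add_lt_sum_of_card_eq (f := lam) (δ := 0)
      (by rw [hcard, card_insert_of_notMem hb]) hTb le_rfl fun x hx y hy => by
        simp only [Finset.mem_sdiff, mem_insert, not_or] at hx hy
        have hy' := hT y hy.1 hy.2.2 (fun h => haT (h ▸ hy.1)) hy.2.1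
        rcases hx.1 with rfl | hxP
        · simpa using hy'
        · linarith [hP x hxP]
    simpa using hsum

theorem heineMean_asymptotics_atTop {a b : ι} (hμ : ∀ j ∈ s, 0 < μ j) (hz : Set.InjOn z s)
    (hnorm : ‖z a‖ = 1) (hPs : P ⊆ s) (has : a ∈ s) (hbs : b ∈ s) (ha : a ∉ P) (hb : b ∉ P)
    (hab : lam b < lam a) (hP : ∀ x ∈ P, lam a < lam x)
    (hrest : ∀ y ∈ s, y ∉ P → y ≠ a → y ≠ b → lam y < lam b) :
    ∃ γ, lam a - lam b < γ ∧
      (fun t => heineMean s z (fun j => μ j * Real.exp (lam j * t)) (#P + 1)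
        - (∏ j ∈ insert a P, conj (z j)) *
          (1 + asymptoticConstant z μ P a b * (Real.exp (-(lam a - lam b) * t) : ℂ)))
        =O[atTop] fun t => Real.exp (-γ * t) := by
  have hmem {c : ι} (hcs : c ∈ s) (hc : c ∉ P) : insert c P ∈ s.powersetCard (#P + 1) :=
    mem_powersetCard.2 ⟨insert_subset hcs hPs, card_insert_of_notMem hc⟩
  have hgap : ∑ j ∈ insert a P, lam j - ∑ j ∈ insert b P, lam j = lam a - lam b := by
    rw [sum_insert ha, sum_insert hb]; ring
  obtain ⟨γ, hγ, hexp⟩ := tiltedMean_asymptotics (I := s.powersetCard (#P + 1))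
    (w := heineWeight z μ) (Λ := fun S => ∑ j ∈ S, lam j) (b := fun S => ∏ j ∈ S, conj (z j))
    (fun S hS => heineWeight_pos (fun j hj => hμ j ((mem_powersetCard.1 hS).1 hj))
      (hz.mono (mem_powersetCard.1 hS).1)) (hmem has ha) (hmem hbs hb)
    (by linarith) (fun T hT => by
      simp only [mem_erase, mem_powersetCard] at hT
      exact sum_lt_sum_insert_of_dominated hb hab hP (fun y hy => hrest y (hT.2.2.1 hy))
        hT.2.2.2 hT.2.1 hT.1)
  have hweightP : heineWeight z μ P ≠ 0 :=
    (heineWeight_pos (fun j hj => hμ j (hPs hj)) (hz.mono hPs)).ne'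
  have hdiff : ∏ j ∈ insert b P, conj (z j) - ∏ j ∈ insert a P, conj (z j) =
      (∏ j ∈ insert a P, conj (z j)) * (z a * conj (z b) - 1) := by
    have hza : conj (z a) * z a = 1 := by rw [Complex.conj_mul', hnorm]; simp
    rw [prod_insert ha, prod_insert hb]
    linear_combination -(conj (z b) * ∏ j ∈ P, conj (z j)) * hza
  simp only [hgap] at hγ hexp
  refine ⟨γ, hγ, hexp.congr_left fun t => ?_⟩
  rw [← heineMean_mul_exp, heineWeight_insert_div_insert ha hb hweightP, hdiff, Complex.real_smul,
    asymptoticConstant]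
  push_cast
  ring

theorem heineMean_asymptotics_atBot {a b : ι} (hμ : ∀ j ∈ s, 0 < μ j) (hz : Set.InjOn z s)
    (hnorm : ‖z a‖ = 1) (hPs : P ⊆ s) (has : a ∈ s) (hbs : b ∈ s) (ha : a ∉ P) (hb : b ∉ P)
    (hab : lam a < lam b) (hP : ∀ x ∈ P, lam x < lam a)
    (hrest : ∀ y ∈ s, y ∉ P → y ≠ a → y ≠ b → lam b < lam y) :
    ∃ γ, lam b - lam a < γ ∧
      (fun t => heineMean s z (fun j => μ j * Real.exp (lam j * t)) (#P + 1)
        - (∏ j ∈ insert a P, conj (z j)) *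
          (1 + asymptoticConstant z μ P a b * (Real.exp ((lam b - lam a) * t) : ℂ)))
        =O[atBot] fun t => Real.exp (γ * t) := by
  obtain ⟨γ, hγ, hO⟩ := heineMean_asymptotics_atTop (lam := fun j => -lam j) hμ hz hnorm hPs has hbs
    ha hb (neg_lt_neg hab) (fun x hx => neg_lt_neg (hP x hx))
    fun y hy hyP hya hyb => neg_lt_neg (hrest y hy hyP hya hyb)
  have hgap : -lam a - -lam b = lam b - lam a := by ring
  rw [hgap] at hγ hO
  exact ⟨γ, hγ, by
    simpa only [Function.comp_def, neg_mul_neg] using hO.comp_tendsto tendsto_neg_atBot_atTop⟩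

end HeineMean

section CauchyBinet

open Finset

variable {ι R : Type*} [CommRing R]

theorem det_mul_eq_sum_embedding [Fintype ι] {m : Type*} [Fintype m] [DecidableEq m]
    (A : Matrix m ι R) (B : Matrix ι m R) :
    (A * B).det = ∑ f : m ↪ ι, (∏ i, A i (f i)) * (B.submatrix f id).det := by
  classical
  have hrows : A * B = fun i => ∑ l, A i l • B l := by
    ext i j
    simp [Matrix.mul_apply]
  have hexpand : (A * B).det = ∑ f : m → ι, (∏ i, A i (f i)) * (B.submatrix f id).det := by
    rw [hrows]
    refine ((Matrix.detRowAlternating (n := m) (R := R)).toMultilinearMap.map_sum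
      fun i l => A i l • B l).trans (sum_congr rfl fun f _ => ?_)
    exact MultilinearMap.map_smul_univ _ (fun i => A i (f i)) fun i => B (f i)
  rw [hexpand]
  refine (Fintype.sum_of_injective (fun f : m ↪ ι => (f : m → ι)) DFunLike.coe_injective _ _
    (fun f hf => ?_) fun f => rfl).symm
  have hf' : ¬ Function.Injective f := fun h => hf ⟨⟨f, h⟩, rfl⟩
  obtain ⟨i, j, hij, hne⟩ := Function.not_injective_iff.1 hf'
  rw [Matrix.det_zero_of_row_eq hne (by ext l; simp [hij]), mul_zero]

theorem bijective_perm_trans_orderEmbedding [LinearOrder ι] (k : ℕ) :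
    Function.Bijective fun p : (Fin k ↪o ι) × Equiv.Perm (Fin k) =>
      p.2.toEmbedding.trans p.1.toEmbedding := by
  constructor
  · rintro ⟨e, σ⟩ ⟨e', τ⟩ h
    have hfun : e ∘ σ = e' ∘ τ := congrArg DFunLike.coe h
    have hrange : Set.range e = Set.range e' := by
      rw [← σ.surjective.range_comp e, hfun, τ.surjective.range_comp]
    obtain rfl : e = e' := OrderEmbedding.range_inj.1 hrange
    exact Prod.ext rfl (Equiv.ext fun i => e.injective (congrFun hfun i))
  · intro f
    refine ⟨⟨OrderEmbedding.ofStrictMono (f ∘ Tuple.sort f)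
      ((Tuple.monotone_sort f).strictMono_of_injective (f.injective.comp (Equiv.injective _))),
      (Tuple.sort f)⁻¹⟩, ?_⟩
    ext i
    simp

theorem det_mul_eq_sum_orderEmbedding [Fintype ι] [LinearOrder ι] {k : ℕ} (A : Matrix (Fin k) ι R)
    (B : Matrix ι (Fin k) R) :
    (A * B).det = ∑ e : Fin k ↪o ι, (A.submatrix id e).det * (B.submatrix e id).det := by
  rw [det_mul_eq_sum_embedding,
    ← (bijective_perm_trans_orderEmbedding k).sum_comp, Fintype.sum_prod_type]
  refine sum_congr rfl fun e _ => ?_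
  rw [← Matrix.det_transpose (A.submatrix id e), Matrix.det_apply', sum_mul]
  refine sum_congr rfl fun σ _ => ?_
  have hperm : (B.submatrix (σ.toEmbedding.trans e.toEmbedding) id).det =
      Equiv.Perm.sign σ * (B.submatrix e id).det :=
    Matrix.det_permute σ (B.submatrix e id)
  rw [hperm, mul_left_comm, mul_assoc]
  rfl

theorem sum_orderEmbedding_map_univ [Fintype ι] [LinearOrder ι] {M : Type*} [AddCommMonoid M]
    (k : ℕ) (F : Finset ι → M) :
    ∑ e : Fin k ↪o ι, F (univ.map e.toEmbedding) = ∑ S ∈ univ.powersetCard k, F S := by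
  refine sum_bij (fun e _ => univ.map e.toEmbedding) (fun e _ => by simp)
    (fun e _ e' _ h => ?_) (fun S hS => ?_) fun _ _ => rfl
  · exact OrderEmbedding.range_inj.1 (by simpa using congrArg (fun S : Finset ι => (S : Set ι)) h)
  · have hcard := (mem_powersetCard.1 hS).2
    exact ⟨S.orderEmbOfFin hcard, mem_univ _, map_orderEmbOfFin_univ S hcard⟩

end CauchyBinet

section HeineDeterminant

open Finset

variable {ι : Type*} {z : ι → ℂ} {μ : ι → ℝ} {k : ℕ}

theorem heineWeight_map_univ [DecidableEq ι] (e : Fin k ↪ ι) :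
    heineWeight z μ (univ.map e) =
      (∏ i, μ (e i)) * ‖(Matrix.vandermonde (z ∘ e)).det‖ ^ 2 := by
  have hpairs : ∏ i, ∏ j ∈ univ.erase i, ‖z (e j) - z (e i)‖ =
      ‖(Matrix.vandermonde (z ∘ e)).det‖ ^ 2 := by
    simp only [← compl_singleton, ← prod_prod_Ioi_mul_eq_prod_prod_off_diag,
      Matrix.det_vandermonde, norm_prod, prod_mul_distrib, Function.comp_apply, sq,
      fun i j => norm_sub_rev (z (e i)) (z (e j))]
  simp only [heineWeight, ← map_erase, prod_map, prod_mul_distrib, hpairs]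

theorem det_mul_diagonal_mul_conjTranspose [Fintype ι] [LinearOrder ι]
    (V : Matrix (Fin k) ι ℂ) (d : ι → ℂ) :
    (V * Matrix.diagonal d * Vᴴ).det =
      ∑ e : Fin k ↪o ι, ‖(V.submatrix id e).det‖ ^ 2 • ∏ i, d (e i) := by
  rw [det_mul_eq_sum_orderEmbedding]
  refine sum_congr rfl fun e _ => ?_
  have hleft : (V * Matrix.diagonal d).submatrix id e =
      V.submatrix id e * Matrix.diagonal (d ∘ e) := by
    ext i j
    simp
  rw [hleft, Matrix.det_mul, Matrix.det_diagonal, ← Matrix.conjTranspose_submatrix,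
    Matrix.det_conjTranspose, mul_right_comm, Complex.star_def, Complex.mul_conj',
    Complex.real_smul]
  push_cast
  rfl

theorem det_eq_centerMass_heineWeight [Fintype ι] [LinearOrder ι] {V : Matrix (Fin k) ι ℂ}
    (hV : V * Vᴴ = 1) {c : ℝ} (hminor : ∀ e : Fin k ↪o ι,
      ‖(V.submatrix id e).det‖ ^ 2 = c * heineWeight z μ (univ.map e.toEmbedding)) (d : ι → ℂ) :
    (V * Matrix.diagonal d * Vᴴ).det =
      (univ.powersetCard k).centerMass (heineWeight z μ) fun S => ∏ j ∈ S, d j := by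
  have hdet (d : ι → ℂ) : (V * Matrix.diagonal d * Vᴴ).det =
      c • ∑ S ∈ univ.powersetCard k, heineWeight z μ S • ∏ j ∈ S, d j := by
    rw [det_mul_diagonal_mul_conjTranspose, ← sum_orderEmbedding_map_univ, smul_sum]
    simp only [hminor, prod_map, mul_smul]
    rfl
  have htotal : c * ∑ S ∈ univ.powersetCard k, heineWeight z μ S = 1 := by
    have hone := hdet 1
    simp only [Pi.one_def, Matrix.diagonal_one, Matrix.mul_one, hV, Matrix.det_one,
      prod_const_one, Complex.real_smul, mul_one] at hone
    exact_mod_cast hone.symm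
  rw [hdet, centerMass, eq_inv_of_mul_eq_one_left htotal]

end HeineDeterminant

section UnitaryBlocks

variable {l m : Type*} [Fintype l] [DecidableEq l] [Fintype m] [DecidableEq m]

theorem fromBlocks_mem_unitaryGroup {A : Matrix l l ℂ} {D : Matrix m m ℂ}
    (hA : A ∈ Matrix.unitaryGroup l ℂ) (hD : D ∈ Matrix.unitaryGroup m ℂ) :
    Matrix.fromBlocks A 0 0 D ∈ Matrix.unitaryGroup (l ⊕ m) ℂ := by
  rw [Matrix.mem_unitaryGroup_iff', Matrix.star_eq_conjTranspose] at hA hD ⊢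
  rw [Matrix.fromBlocks_conjTranspose, Matrix.fromBlocks_multiply]
  simp [hA, hD]

theorem submatrix_equiv_mem_unitaryGroup_iff (e : l ≃ m) {A : Matrix m m ℂ} :
    A.submatrix e e ∈ Matrix.unitaryGroup l ℂ ↔ A ∈ Matrix.unitaryGroup m ℂ := by
  rw [Matrix.mem_unitaryGroup_iff', Matrix.mem_unitaryGroup_iff', Matrix.star_eq_conjTranspose,
    Matrix.conjTranspose_submatrix, Matrix.submatrix_mul_equiv, ← Matrix.star_eq_conjTranspose,
    ← Matrix.submatrix_one_equiv e]
  exact (Matrix.reindex (α := ℂ) e.symm e.symm).apply_eq_iff_eq (x := star A * A) (y := 1)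

theorem mem_unitaryGroup_fin_one {a : ℂ} (ha : ‖a‖ = 1) :
    !![a] ∈ Matrix.unitaryGroup (Fin 1) ℂ := by
  rw [Matrix.mem_unitaryGroup_iff']
  ext i j
  obtain rfl := Subsingleton.elim i j
  simp [Matrix.mul_apply, Complex.conj_mul', ha]

end UnitaryBlocks

section BlockStructure

variable {α : ℕ → ℂ} {k n p i j : ℕ}

/-- The entries of `blockDiag`, indexed by natural numbers: they do not depend on the size of the
matrix. -/
noncomputable def blockEntry (α : ℕ → ℂ) (p i j : ℕ) : ℂ :=
  if i = j then
    if i % 2 = p % 2 then conj (α i) else -shifted α i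
  else if j = i + 1 ∧ i % 2 = p % 2 then (rho α i : ℂ)
  else if i = j + 1 ∧ j % 2 = p % 2 then (rho α j : ℂ)
  else 0

theorem blockDiag_apply (n : ℕ) (α : ℕ → ℂ) (p : ℕ) (i j : Fin n) :
    blockDiag n α p i j = blockEntry α p i j := by
  simp [blockDiag, blockEntry, Fin.ext_iff]

theorem blockEntry_self (h : i % 2 = p % 2) : blockEntry α p i i = conj (α i) := by
  simp [blockEntry, h]

theorem blockEntry_succ_succ (h : i % 2 = p % 2) :
    blockEntry α p (i + 1) (i + 1) = -α i := by
  have : ¬ (i + 1) % 2 = p % 2 := by omega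
  simp [blockEntry, this, shifted]

theorem blockEntry_zero_zero (h : p % 2 = 1) : blockEntry α p 0 0 = 1 := by
  simp [blockEntry, h, shifted]

theorem blockEntry_self_succ (h : i % 2 = p % 2) : blockEntry α p i (i + 1) = rho α i := by
  simp [blockEntry, h]

theorem blockEntry_succ_self (h : i % 2 = p % 2) : blockEntry α p (i + 1) i = rho α i := by
  rw [blockEntry, if_neg (by omega), if_neg (by omega), if_pos ⟨rfl, h⟩]

theorem blockEntry_eq_zero (h : i ≠ j) (hij : ¬ (j = i + 1 ∧ i % 2 = p % 2))
    (hji : ¬ (i = j + 1 ∧ j % 2 = p % 2)) : blockEntry α p i j = 0 := by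
  simp [blockEntry, h, hij, hji]

theorem rho_mul_self (h : ‖α k‖ ≤ 1) : (rho α k : ℂ) * rho α k = 1 - α k * conj (α k) := by
  rw [Complex.mul_conj', ← Complex.ofReal_mul, rho,
    Real.mul_self_sqrt (by nlinarith [norm_nonneg (α k)])]
  push_cast
  rfl

theorem rho_ne_zero (h : ‖α k‖ < 1) : (rho α k : ℂ) ≠ 0 := by
  have hpos : 0 < rho α k := Real.sqrt_pos.2 (by nlinarith [norm_nonneg (α k)])
  exact_mod_cast hpos.ne'

/-- The block `Ξ_k` of a CMV matrix. -/
noncomputable def Xi (α : ℕ → ℂ) (k : ℕ) : Matrix (Fin 2) (Fin 2) ℂ :=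
  !![conj (α k), (rho α k : ℂ); (rho α k : ℂ), -α k]

theorem det_Xi (h : ‖α k‖ ≤ 1) : (Xi α k).det = -1 := by
  rw [Xi, Matrix.det_fin_two_of, rho_mul_self h]
  ring

theorem Xi_mem_unitaryGroup (h : ‖α k‖ ≤ 1) : Xi α k ∈ Matrix.unitaryGroup (Fin 2) ℂ := by
  rw [Matrix.mem_unitaryGroup_iff', Matrix.star_eq_conjTranspose]
  ext i j
  fin_cases i <;> fin_cases j <;>
    simp [Xi, Matrix.mul_apply, Fin.sum_univ_two, rho_mul_self h] <;> ring

theorem blockDiag_succ_submatrix (α : ℕ → ℂ) (h : k % 2 = p % 2) :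
    (blockDiag (k + 1) α p).submatrix finSumFinEquiv finSumFinEquiv =
      Matrix.fromBlocks (blockDiag k α p) 0 0 !![conj (α k)] := by
  ext (i | i) (j | j)
  · simp [blockDiag_apply]
  · simp only [Matrix.submatrix_apply, blockDiag_apply, Matrix.fromBlocks_apply₁₂,
      finSumFinEquiv_apply_left, finSumFinEquiv_apply_right, Matrix.zero_apply]
    apply blockEntry_eq_zero <;> simp <;> omega
  · simp only [Matrix.submatrix_apply, blockDiag_apply, Matrix.fromBlocks_apply₂₁,
      finSumFinEquiv_apply_left, finSumFinEquiv_apply_right, Matrix.zero_apply]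
    apply blockEntry_eq_zero <;> simp <;> omega
  · simp [Fin.fin_one_eq_zero, blockDiag_apply, blockEntry_self h]

theorem blockDiag_add_two_submatrix (α : ℕ → ℂ) (h : k % 2 = p % 2) :
    (blockDiag (k + 2) α p).submatrix finSumFinEquiv finSumFinEquiv =
      Matrix.fromBlocks (blockDiag k α p) 0 0 (Xi α k) := by
  ext (i | i) (j | j)
  · simp [blockDiag_apply]
  · simp only [Matrix.submatrix_apply, blockDiag_apply, Matrix.fromBlocks_apply₁₂,
      finSumFinEquiv_apply_left, finSumFinEquiv_apply_right, Matrix.zero_apply]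
    apply blockEntry_eq_zero <;> simp <;> omega
  · simp only [Matrix.submatrix_apply, blockDiag_apply, Matrix.fromBlocks_apply₂₁,
      finSumFinEquiv_apply_left, finSumFinEquiv_apply_right, Matrix.zero_apply]
    apply blockEntry_eq_zero <;> simp <;> omega
  · fin_cases i <;> fin_cases j <;>
    simp [blockDiag_apply, blockEntry_self h, blockEntry_succ_self h, blockEntry_self_succ h,
      blockEntry_succ_succ h, Xi]

theorem blockDiag_congr_parity (n : ℕ) (α : ℕ → ℂ) {q : ℕ} (h : p % 2 = q % 2) :
    blockDiag n α p = blockDiag n α q := by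
  simp [blockDiag, h]

theorem det_blockDiag_succ (α : ℕ → ℂ) (h : k % 2 = p % 2) :
    (blockDiag (k + 1) α p).det = conj (α k) * (blockDiag k α p).det := by
  rw [← Matrix.det_submatrix_equiv_self finSumFinEquiv, blockDiag_succ_submatrix α h,
    Matrix.det_fromBlocks_zero₁₂]
  simp [mul_comm]

theorem det_blockDiag_add_two (h : k % 2 = p % 2) (hα : ‖α k‖ ≤ 1) :
    (blockDiag (k + 2) α p).det = -(blockDiag k α p).det := by
  rw [← Matrix.det_submatrix_equiv_self finSumFinEquiv, blockDiag_add_two_submatrix α h,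
    Matrix.det_fromBlocks_zero₁₂, det_Xi hα]
  simp

theorem det_blockDiag_mul_det_blockDiag_succ (k : ℕ) (hα : ∀ j < k, ‖α j‖ ≤ 1) :
    (blockDiag k α k).det * (blockDiag (k + 1) α (k + 1)).det = (-1) ^ k := by
  induction k with
  | zero => simp [Matrix.det_fin_zero, blockDiag_apply, blockEntry_zero_zero]
  | succ k ih =>
    rw [blockDiag_congr_parity (k + 1 + 1) α (Nat.add_mod_right k 2),
      det_blockDiag_add_two rfl (hα k k.lt_succ_self), pow_succ,
      ← ih fun j hj => hα j (by omega)]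
    ring

theorem det_cmv_succ (k : ℕ) (hα : ∀ j < k, ‖α j‖ ≤ 1) :
    (cmv (k + 1) α).det = (-1) ^ k * conj (α k) := by
  have hfactors : (cmv (k + 1) α).det =
      (blockDiag (k + 1) α k).det * (blockDiag (k + 1) α (k + 1)).det := by
    rw [cmv, Matrix.det_mul]
    rcases Nat.mod_two_eq_zero_or_one k with h | h
    · rw [blockDiag_congr_parity _ α (p := k) (q := 0) h,
        blockDiag_congr_parity _ α (p := k + 1) (q := 1) (by omega)]
    · rw [blockDiag_congr_parity _ α (p := k) (q := 1) h,
        blockDiag_congr_parity _ α (p := k + 1) (q := 0) (by omega), mul_comm]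
  rw [hfactors, det_blockDiag_succ α rfl, ← det_blockDiag_mul_det_blockDiag_succ k hα]
  ring

theorem det_cmv (hα : IsVerblunsky n α) (hk : k ≤ n) :
    (cmv k α).det = (-1) ^ (k + 1) * conj (shifted α k) := by
  cases k with
  | zero => simp [shifted]
  | succ k =>
    rw [det_cmv_succ k fun j hj => (hα.1 j (by omega)).le, shifted]
    ring

theorem shifted_eq_det_conjTranspose_cmv (hα : IsVerblunsky n α) (hk : k ≤ n) :
    shifted α k = (-1) ^ (k + 1) * (cmv k α)ᴴ.det := by
  rw [Matrix.det_conjTranspose, det_cmv hα hk, star_mul', star_pow, star_neg, star_one,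
    Complex.star_def, Complex.conj_conj, ← mul_assoc, ← mul_pow, neg_one_mul, neg_neg, one_pow,
    one_mul]

theorem cmv_submatrix_castLE (h : k ≤ n) (α : ℕ → ℂ) :
    (cmv n α).submatrix (Fin.castLE h) (Fin.castLE h) = cmv k α := by
  ext i j
  simp only [cmv, Matrix.submatrix_apply, Matrix.mul_apply]
  rw [← Finset.sum_subset (Finset.subset_univ (Finset.univ.map (Fin.castLEEmb h)))]
  · simp [blockDiag_apply]
  · intro l _ hl
    have hkl : k ≤ l := by
      by_contra! hlt
      exact hl (Finset.mem_map.2 ⟨⟨l, hlt⟩, Finset.mem_univ _, rfl⟩)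
    simp only [blockDiag_apply, Fin.val_castLE]
    have hi := i.2
    have hj := j.2
    rcases Nat.mod_two_eq_zero_or_one l with heven | hodd
    · rw [blockEntry_eq_zero (by omega) (by omega) (by omega), zero_mul]
    · rw [mul_comm, blockEntry_eq_zero (by omega) (by omega) (by omega), zero_mul]

theorem blockDiag_mem_unitaryGroup_of_parity (k p : ℕ) (h : k % 2 = p % 2)
    (hα : ∀ j, j + 1 < k → ‖α j‖ ≤ 1) : blockDiag k α p ∈ Matrix.unitaryGroup (Fin k) ℂ := by
  induction k using Nat.strong_induction_on with
  | _ k ih =>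
    match k with
    | 0 => rw [Subsingleton.elim (blockDiag 0 α p) 1]; exact one_mem _
    | 1 =>
      have hone : blockDiag 1 α p = 1 := by
        ext i j
        obtain rfl := Subsingleton.elim i j
        simp [Fin.fin_one_eq_zero, blockDiag_apply, blockEntry_zero_zero h.symm]
      exact hone ▸ one_mem _
    | k + 2 =>
      have hk : k % 2 = p % 2 := by omega
      rw [← submatrix_equiv_mem_unitaryGroup_iff finSumFinEquiv, blockDiag_add_two_submatrix α hk]
      exact fromBlocks_mem_unitaryGroup (ih k (by omega) hk fun j hj => hα j (by omega))
        (Xi_mem_unitaryGroup (hα k (by omega)))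

theorem blockDiag_mem_unitaryGroup (hα : IsVerblunsky n α) (p : ℕ) :
    blockDiag n α p ∈ Matrix.unitaryGroup (Fin n) ℂ := by
  have hle (j : ℕ) (hj : j + 1 < n) : ‖α j‖ ≤ 1 := (hα.1 j hj).le
  by_cases h : n % 2 = p % 2
  · exact blockDiag_mem_unitaryGroup_of_parity n p h hle
  · cases n with
    | zero => rw [Subsingleton.elim (blockDiag 0 α p) 1]; exact one_mem _
    | succ k =>
      have hk : k % 2 = p % 2 := by omega
      rw [← submatrix_equiv_mem_unitaryGroup_iff finSumFinEquiv, blockDiag_succ_submatrix α hk]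
      exact fromBlocks_mem_unitaryGroup
        (blockDiag_mem_unitaryGroup_of_parity k p hk fun j hj => hle j (by omega))
        (mem_unitaryGroup_fin_one (by simpa using hα.2))

theorem cmv_mem_unitaryGroup (hα : IsVerblunsky n α) :
    cmv n α ∈ Matrix.unitaryGroup (Fin n) ℂ :=
  mul_mem (blockDiag_mem_unitaryGroup hα 0) (blockDiag_mem_unitaryGroup hα 1)

end BlockStructure

section Eigenvectors

open Polynomial

variable {α : ℕ → ℂ} {n p i : ℕ}

theorem blockDiag_mulVec (α : ℕ → ℂ) (h : i % 2 = p % 2) (hi : i + 1 < n) (x : Fin n → ℂ) :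
    (blockDiag n α p *ᵥ x) ⟨i, by omega⟩ =
      conj (α i) * x ⟨i, by omega⟩ + rho α i * x ⟨i + 1, hi⟩ := by
  rw [Matrix.mulVec, dotProduct, Fintype.sum_eq_add ⟨i, by omega⟩ ⟨i + 1, hi⟩
    (by rw [ne_eq, Fin.mk.injEq]; omega)]
  · simp [blockDiag_apply, blockEntry_self h, blockEntry_self_succ h]
  · rintro ⟨l, hl⟩ ⟨hli, hli'⟩
    simp only [ne_eq, Fin.mk.injEq] at hli hli'
    rw [blockDiag_apply, blockEntry_eq_zero (by simp; omega) (by simp; omega) (by simp; omega),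
      zero_mul]

theorem blockDiag_mulVec_succ (α : ℕ → ℂ) (h : i % 2 = p % 2) (hi : i + 1 < n) (x : Fin n → ℂ) :
    (blockDiag n α p *ᵥ x) ⟨i + 1, hi⟩ =
      rho α i * x ⟨i, by omega⟩ - α i * x ⟨i + 1, hi⟩ := by
  rw [Matrix.mulVec, dotProduct, Fintype.sum_eq_add ⟨i, by omega⟩ ⟨i + 1, hi⟩
    (by rw [ne_eq, Fin.mk.injEq]; omega)]
  · simp [blockDiag_apply, blockEntry_succ_self h, blockEntry_succ_succ h, sub_eq_add_neg]
  · rintro ⟨l, hl⟩ ⟨hli, hli'⟩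
    simp only [ne_eq, Fin.mk.injEq] at hli hli'
    rw [blockDiag_apply, blockEntry_eq_zero (by simp; omega) (by simp; omega) (by simp; omega),
      zero_mul]

theorem blockDiag_one_mulVec_zero (α : ℕ → ℂ) (hn : 0 < n) (x : Fin n → ℂ) :
    (blockDiag n α 1 *ᵥ x) ⟨0, hn⟩ = x ⟨0, hn⟩ := by
  rw [Matrix.mulVec, dotProduct, Fintype.sum_eq_single ⟨0, hn⟩]
  · simp [blockDiag_apply, blockEntry_zero_zero]
  · rintro ⟨l, hl⟩ hl0
    simp only [ne_eq, Fin.mk.injEq] at hl0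
    rw [blockDiag_apply, blockEntry_eq_zero (by simp; omega) (by simp) (by simp), zero_mul]

theorem rho_mul_apply_succ (hα : IsVerblunsky n α) (h : i % 2 = p % 2) (hi : i + 1 < n)
    {x y : Fin n → ℂ} (hxy : blockDiag n α p *ᵥ x = y) :
    rho α i * x ⟨i + 1, hi⟩ = y ⟨i, by omega⟩ - conj (α i) * x ⟨i, by omega⟩ ∧
      rho α i * y ⟨i + 1, hi⟩ = x ⟨i, by omega⟩ - α i * y ⟨i, by omega⟩ := by
  subst hxy
  rw [blockDiag_mulVec α h hi, blockDiag_mulVec_succ α h hi]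
  refine ⟨by ring, ?_⟩
  linear_combination x ⟨i, by omega⟩ * rho_mul_self (hα.1 i hi).le

/-- The orthonormal Szegő polynomials `(φ_k, φ_k^*)` with Verblunsky coefficients `α`, generated by
the normalized Szegő recursion from `φ_0 = φ_0^* = 1`. -/
noncomputable def szego (α : ℕ → ℂ) : ℕ → ℂ[X] × ℂ[X]
  | 0 => (1, 1)
  | k + 1 =>
    (C (rho α k : ℂ)⁻¹ * (X * (szego α k).1 - C (conj (α k)) * (szego α k).2),
      C (rho α k : ℂ)⁻¹ * ((szego α k).2 - C (α k) * (X * (szego α k).1)))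

theorem natDegree_szego_le (α : ℕ → ℂ) (k : ℕ) :
    (szego α k).1.natDegree ≤ k ∧ (szego α k).2.natDegree ≤ k := by
  induction k with
  | zero => simp [szego]
  | succ k ih =>
    obtain ⟨hφ, hφstar⟩ := ih
    have hX : (X * (szego α k).1).natDegree ≤ k + 1 :=
      natDegree_mul_le.trans (by rw [natDegree_X]; omega)
    exact ⟨(natDegree_C_mul_le _ _).trans (natDegree_sub_le_of_le hX
        ((natDegree_C_mul_le _ _).trans (by omega)) |>.trans (max_self _).le),
      (natDegree_C_mul_le _ _).trans (natDegree_sub_le_of_le (hφstar.trans k.le_succ)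
        ((natDegree_C_mul_le _ _).trans hX) |>.trans (max_self _).le)⟩

theorem rho_mul_eval_szego_succ {k : ℕ} (h : ‖α k‖ < 1) (z : ℂ) :
    rho α k * (szego α (k + 1)).1.eval z =
        z * (szego α k).1.eval z - conj (α k) * (szego α k).2.eval z ∧
      rho α k * (szego α (k + 1)).2.eval z =
        (szego α k).2.eval z - α k * (z * (szego α k).1.eval z) := by
  simp only [szego, eval_mul, eval_sub, eval_C, eval_X, mul_inv_cancel_left₀ (rho_ne_zero h),
    and_self]

theorem mul_apply_succ_eq_szego (hα : IsVerblunsky n α) (h : i % 2 = p % 2) (hi : i + 1 < n)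
    {x y : Fin n → ℂ} (hxy : blockDiag n α p *ᵥ x = y) {a b z : ℂ}
    (hy : a * y ⟨i, by omega⟩ = z * (szego α i).1.eval z * b)
    (hx : a * x ⟨i, by omega⟩ = (szego α i).2.eval z * b) :
    a * x ⟨i + 1, hi⟩ = (szego α (i + 1)).1.eval z * b ∧
      a * y ⟨i + 1, hi⟩ = (szego α (i + 1)).2.eval z * b := by
  have hlt := hα.1 i hi
  obtain ⟨hφ, hφstar⟩ := rho_mul_eval_szego_succ hlt z
  obtain ⟨hxsucc, hysucc⟩ := rho_mul_apply_succ hα h hi hxy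
  constructor <;> refine mul_left_cancel₀ (rho_ne_zero hlt) ?_
  · linear_combination a * hxsucc + hy - conj (α i) * hx - b * hφ
  · linear_combination a * hysucc + hx - α i * hy - b * hφstar

section

variable {z : ℂ} {v : Fin n → ℂ}

theorem eigenvector_eq_szego (hα : IsVerblunsky n α) (hv : cmv n α *ᵥ v = z • v) (m : ℕ) :
    (∀ h : 2 * m < n, z ^ m * v ⟨2 * m, h⟩ = (szego α (2 * m)).1.eval z * v ⟨0, by omega⟩ ∧
      z ^ m * (blockDiag n α 1 *ᵥ v) ⟨2 * m, h⟩ =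
        (szego α (2 * m)).2.eval z * v ⟨0, by omega⟩) ∧
    ∀ h : 2 * m + 1 < n,
      z ^ m * (blockDiag n α 1 *ᵥ v) ⟨2 * m + 1, h⟩ =
        (szego α (2 * m + 1)).1.eval z * v ⟨0, by omega⟩ ∧
      z ^ (m + 1) * v ⟨2 * m + 1, h⟩ = (szego α (2 * m + 1)).2.eval z * v ⟨0, by omega⟩ := by
  have hL : blockDiag n α 0 *ᵥ (blockDiag n α 1 *ᵥ v) = z • v := by
    rw [Matrix.mulVec_mulVec, ← hv, cmv]
  have odd_of_even {m : ℕ} (h : 2 * m + 1 < n)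
      (hm : z ^ m * v ⟨2 * m, by omega⟩ = (szego α (2 * m)).1.eval z * v ⟨0, by omega⟩ ∧
        z ^ m * (blockDiag n α 1 *ᵥ v) ⟨2 * m, by omega⟩ =
          (szego α (2 * m)).2.eval z * v ⟨0, by omega⟩) :=
    mul_apply_succ_eq_szego hα (by omega) h hL (a := z ^ m) (b := v ⟨0, by omega⟩)
      (by simp only [Pi.smul_apply, smul_eq_mul]; linear_combination z * hm.1) hm.2
  simp only [Pi.smul_apply, smul_eq_mul, ← mul_assoc, ← pow_succ] at odd_of_even
  induction m with
  | zero =>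
    have hzero (h : 2 * 0 < n) : z ^ 0 * v ⟨0, h⟩ = (szego α 0).1.eval z * v ⟨0, h⟩ ∧
        z ^ 0 * (blockDiag n α 1 *ᵥ v) ⟨0, h⟩ = (szego α 0).2.eval z * v ⟨0, h⟩ := by
      simp [szego, blockDiag_one_mulVec_zero]
    exact ⟨hzero, fun h => odd_of_even h (hzero (by omega))⟩
  | succ m ih =>
    have heven (h : 2 * m + 1 + 1 < n) :=
      mul_apply_succ_eq_szego hα (p := 1) (by omega) h rfl (a := z ^ (m + 1))
        (b := v ⟨0, by omega⟩) (by linear_combination z * (ih.2 (by omega)).1) (ih.2 (by omega)).2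
    exact ⟨heven, fun h => odd_of_even h (heven (by omega))⟩

theorem eigenvector_zero_ne_zero (hn : 0 < n) (hα : IsVerblunsky n α) (hz : z ≠ 0)
    (hv : cmv n α *ᵥ v = z • v) (hv0 : v ≠ 0) : v ⟨0, hn⟩ ≠ 0 := by
  refine fun hzero => hv0 (funext fun ⟨i, hi⟩ => ?_)
  obtain ⟨m, rfl | rfl⟩ := Nat.even_or_odd' i
  · simpa [hzero, hz] using ((eigenvector_eq_szego hα hv m).1 hi).1
  · simpa [hzero, hz] using ((eigenvector_eq_szego hα hv m).2 hi).2

end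

theorem exists_polynomial_eigenvector (hα : IsVerblunsky n α) {k : ℕ} (hik : i < k) (hk : k ≤ n) :
    ∃ P : ℂ[X], P.natDegree < k ∧ ∀ (z : ℂ) (v : Fin n → ℂ), cmv n α *ᵥ v = z • v →
      z ^ (k / 2) * v ⟨i, by omega⟩ = P.eval z * v ⟨0, by omega⟩ := by
  have hdegree (P : ℂ[X]) (l : ℕ) (hP : P.natDegree ≤ i) (hl : i + l < k) :
      (X ^ l * P).natDegree < k := by
    refine natDegree_mul_le.trans_lt ?_
    rw [natDegree_X_pow]
    omega
  obtain ⟨m, rfl | rfl⟩ := Nat.even_or_odd' i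
  · refine ⟨X ^ (k / 2 - m) * (szego α (2 * m)).1,
      hdegree _ _ (natDegree_szego_le α _).1 (by omega), fun z v hv => ?_⟩
    rw [eval_mul, eval_pow, eval_X, mul_assoc, ← ((eigenvector_eq_szego hα hv m).1 _).1,
      ← mul_assoc, ← pow_add, Nat.sub_add_cancel (by omega)]
  · refine ⟨X ^ (k / 2 - (m + 1)) * (szego α (2 * m + 1)).2,
      hdegree _ _ (natDegree_szego_le α _).2 (by omega), fun z v hv => ?_⟩
    rw [eval_mul, eval_pow, eval_X, mul_assoc, ← ((eigenvector_eq_szego hα hv m).2 _).2,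
      ← mul_assoc, ← pow_add, Nat.sub_add_cancel (by omega)]

theorem exists_norm_det_eigenvectors_eq (hα : IsVerblunsky n α) (hn : 0 < n) {k : ℕ} (hk : k ≤ n) :
    ∃ c : ℝ, ∀ (z : Fin k → ℂ) (V : Matrix (Fin n) (Fin k) ℂ), (∀ j, ‖z j‖ = 1) →
      cmv n α * V = V * Matrix.diagonal z →
      ‖(V.submatrix (Fin.castLE hk) id).det‖ ^ 2 =
        c * ((∏ j, ‖V ⟨0, hn⟩ j‖ ^ 2) * ‖(Matrix.vandermonde z).det‖ ^ 2) := by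
  choose P hdegree hP using fun i : Fin k => exists_polynomial_eigenvector hα i.2 hk
  let T : Matrix (Fin k) (Fin k) ℂ := Matrix.of fun i l => (P i).coeff l
  refine ⟨‖T.det‖ ^ 2, fun z V hz hV => ?_⟩
  have hcolumn (j : Fin k) : cmv n α *ᵥ V.col j = z j • V.col j := by
    ext i
    exact (congrFun (congrFun hV i) j).trans (by simp [Matrix.mul_diagonal, mul_comm])
  have hfactor : V.submatrix (Fin.castLE hk) id * Matrix.diagonal (fun j => z j ^ (k / 2)) =
      T * (Matrix.vandermonde z)ᵀ * Matrix.diagonal (V ⟨0, hn⟩) := by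
    ext i j
    have heval : (T * (Matrix.vandermonde z)ᵀ) i j = (P i).eval (z j) := by
      rw [eval_eq_sum_range' (hdegree i), ← Fin.sum_univ_eq_sum_range
        (fun l => (P i).coeff l * z j ^ l) k]
      rfl
    rw [Matrix.mul_diagonal, Matrix.mul_diagonal, heval, mul_comm]
    exact hP i (z j) (V.col j) (hcolumn j)
  have hdet := congrArg (fun M : Matrix (Fin k) (Fin k) ℂ => ‖M.det‖ ^ 2) hfactor
  simp only [Matrix.det_mul, Matrix.det_diagonal, Matrix.det_transpose, norm_mul, norm_prod,
    norm_pow, hz, one_pow, Finset.prod_const_one, mul_one] at hdet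
  rw [hdet, Finset.prod_pow]
  ring

end Eigenvectors

section UnitaryDiagonalization

variable {m ι : Type*} [Fintype m] [DecidableEq m] [Fintype ι] [DecidableEq ι]

/-- The columns of `V` form an orthonormal basis of eigenvectors of `C`, for the eigenvalues `z`.
The eigenvectors may be indexed by a type other than that of the coordinates. -/
structure IsUnitaryDiagonalization (C : Matrix m m ℂ) (z : ι → ℂ) (V : Matrix m ι ℂ) : Prop where
  mul_conjTranspose : V * Vᴴ = 1
  conjTranspose_mul : Vᴴ * V = 1
  mul_eq : C * V = V * Matrix.diagonal z

open scoped Matrix.Norms.L2Operator in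
theorem norm_eq_one_of_mem_spectrum {C : Matrix m m ℂ} (hC : C ∈ Matrix.unitaryGroup m ℂ) {w : ℂ}
    (hw : w ∈ spectrum ℂ C) : ‖w‖ = 1 :=
  spectrum.norm_eq_one_of_unitary hC hw

theorem exists_unit_eigenvector {C : Matrix m m ℂ} {w : ℂ} (hw : w ∈ spectrum ℂ C) :
    ∃ v : m → ℂ, C *ᵥ v = w • v ∧ star v ⬝ᵥ v = 1 := by
  rw [← Matrix.spectrum_toLpLin 2, ← Module.End.hasEigenvalue_iff_mem_spectrum] at hw
  obtain ⟨x, hx⟩ := hw.exists_hasEigenvector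
  have heigen : C *ᵥ x.ofLp = w • x.ofLp := by
    simpa using congrArg WithLp.ofLp hx.apply_eq_smul
  refine ⟨((‖x‖ : ℂ)⁻¹ • x).ofLp, ?_, ?_⟩
  · rw [WithLp.ofLp_smul, Matrix.mulVec_smul, heigen, smul_comm]
  · rw [dotProduct_comm, ← EuclideanSpace.inner_eq_star_dotProduct, inner_self_eq_norm_sq_to_K]
    simp [norm_smul, hx.2]

theorem exists_isUnitaryDiagonalization {C : Matrix m m ℂ} (hC : C ∈ Matrix.unitaryGroup m ℂ)
    (hcard : Fintype.card ι = Fintype.card m) {z : ι → ℂ} (hinj : Function.Injective z)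
    (hz : ∀ j, z j ∈ spectrum ℂ C) : ∃ V : Matrix m ι ℂ, IsUnitaryDiagonalization C z V := by
  choose v heigen hunit using fun j => exists_unit_eigenvector (hz j)
  let V : Matrix m ι ℂ := Matrix.of fun i j => v j i
  have hmul : C * V = V * Matrix.diagonal z := by
    ext i j
    exact (congrFun (heigen j) i).trans (by simp [V, mul_comm])
  have hgram : Vᴴ * V = (Matrix.diagonal z)ᴴ * (Vᴴ * V) * Matrix.diagonal z := by
    rw [← Matrix.mul_assoc, ← Matrix.conjTranspose_mul, Matrix.mul_assoc, ← hmul,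
      Matrix.conjTranspose_mul, Matrix.mul_assoc, ← Matrix.mul_assoc Cᴴ,
      ← Matrix.star_eq_conjTranspose C, Matrix.mem_unitaryGroup_iff'.1 hC, Matrix.one_mul]
  have horthonormal : Vᴴ * V = 1 := by
    ext i j
    obtain rfl | hij := eq_or_ne i j
    · rw [Matrix.one_apply_eq, ← hunit i]
      rfl
    · have hfixed := congrFun (congrFun hgram i) j
      rw [Matrix.diagonal_conjTranspose, Matrix.mul_diagonal, Matrix.diagonal_mul] at hfixed
      have hzi : z i * conj (z i) = 1 := by
        rw [Complex.mul_conj', norm_eq_one_of_mem_spectrum hC (hz i)]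
        simp
      have hzij : z i - z j ≠ 0 := sub_ne_zero.2 (hinj.ne hij)
      rw [Matrix.one_apply_ne hij]
      refine (mul_eq_zero.1 ?_).resolve_left hzij
      simp only [Pi.star_apply, Complex.star_def] at hfixed
      linear_combination z i * hfixed + z j * (Vᴴ * V) i j * hzi
  exact ⟨V, (Matrix.mul_eq_one_comm_of_card_eq m ι ℂ hcard.symm).2 horthonormal, horthonormal, hmul⟩

namespace IsUnitaryDiagonalization

variable {C : Matrix m m ℂ} {z : ι → ℂ} {V : Matrix m ι ℂ}

theorem eq_mul_diagonal_mul (h : IsUnitaryDiagonalization C z V) :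
    C = V * Matrix.diagonal z * Vᴴ := by
  rw [← h.mul_eq, Matrix.mul_assoc, h.mul_conjTranspose, Matrix.mul_one]

theorem conjTranspose_eq (h : IsUnitaryDiagonalization C z V) (hz : ∀ j, conj (z j) = z j) :
    Cᴴ = C := by
  have hdiag : (Matrix.diagonal z)ᴴ = Matrix.diagonal z := by
    rw [Matrix.diagonal_conjTranspose]
    exact congrArg Matrix.diagonal (funext hz)
  rw [h.eq_mul_diagonal_mul, Matrix.conjTranspose_mul, Matrix.conjTranspose_mul,
    Matrix.conjTranspose_conjTranspose, hdiag, Matrix.mul_assoc]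

theorem aeval (h : IsUnitaryDiagonalization C z V) (p : Polynomial ℂ) :
    IsUnitaryDiagonalization (Polynomial.aeval C p) (fun j => p.eval (z j)) V := by
  refine ⟨h.mul_conjTranspose, h.conjTranspose_mul, ?_⟩
  induction p using Polynomial.induction_on' with
  | add p q hp hq =>
    rw [map_add, Matrix.add_mul, hp, hq, ← Matrix.mul_add, Matrix.diagonal_add]
    simp only [Polynomial.eval_add]
  | monomial k a =>
    have hpow : C ^ k * V = V * Matrix.diagonal z ^ k := by
      induction k with
      | zero => simp
      | succ k ih =>
        rw [pow_succ, Matrix.mul_assoc, h.mul_eq, ← Matrix.mul_assoc, ih, Matrix.mul_assoc,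
          ← pow_succ]
    rw [Polynomial.aeval_monomial, ← Algebra.smul_def, Matrix.smul_mul, hpow,
      Matrix.diagonal_pow, ← Matrix.mul_smul, ← Matrix.diagonal_smul]
    simp only [Polynomial.eval_monomial]
    rfl

theorem apply_self (h : IsUnitaryDiagonalization C z V) (o : m) :
    C o o = ∑ j, ‖V o j‖ ^ 2 * z j := by
  rw [h.eq_mul_diagonal_mul, Matrix.mul_apply]
  refine Finset.sum_congr rfl fun j _ => ?_
  rw [Matrix.mul_diagonal, Matrix.conjTranspose_apply, mul_right_comm, Complex.star_def,
    Complex.mul_conj']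

theorem mulVec_col (h : IsUnitaryDiagonalization C z V) (j : ι) : C *ᵥ V.col j = z j • V.col j := by
  ext i
  exact (congrFun (congrFun h.mul_eq i) j).trans (by simp [Matrix.mul_diagonal, mul_comm])

theorem star_col_dotProduct_col (h : IsUnitaryDiagonalization C z V) (j : ι) :
    star (V.col j) ⬝ᵥ V.col j = 1 := by
  rw [← Matrix.one_apply_eq (α := ℂ) j, ← h.conjTranspose_mul]
  rfl

theorem eq_smul_col_of_mulVec_eq_smul (h : IsUnitaryDiagonalization C z V)
    (hinj : Function.Injective z) {j : ι} {x : m → ℂ} (hx : C *ᵥ x = z j • x) :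
    x = (Vᴴ *ᵥ x) j • V.col j := by
  have hexpand : V *ᵥ (Vᴴ *ᵥ x) = x := by
    rw [Matrix.mulVec_mulVec, h.mul_conjTranspose, Matrix.one_mulVec]
  have hcoord : Matrix.diagonal z *ᵥ (Vᴴ *ᵥ x) = z j • (Vᴴ *ᵥ x) := by
    rw [← Matrix.mulVec_smul, ← hx, h.eq_mul_diagonal_mul, Matrix.mulVec_mulVec,
      Matrix.mulVec_mulVec, ← Matrix.mul_assoc, ← Matrix.mul_assoc, h.conjTranspose_mul,
      Matrix.one_mul]
  have hsupport : Vᴴ *ᵥ x = Pi.single j ((Vᴴ *ᵥ x) j) := by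
    ext l
    obtain rfl | hl := eq_or_ne l j
    · simp
    · have hzl := congrFun hcoord l
      rw [Matrix.mulVec_diagonal, Pi.smul_apply, smul_eq_mul] at hzl
      rw [Pi.single_eq_of_ne hl]
      exact (mul_eq_mul_right_iff.1 hzl).resolve_left (hinj.ne hl)
  conv_lhs => rw [← hexpand, hsupport, Matrix.mulVec_single]
  ext i
  simp [mul_comm]

theorem eigenspace_eq_span (h : IsUnitaryDiagonalization C z V) (hinj : Function.Injective z)
    (j : ι) : Module.End.eigenspace (Matrix.toEuclideanLin C) (z j) =
      Submodule.span ℂ {WithLp.toLp 2 (V.col j)} := by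
  ext x
  rw [Module.End.mem_eigenspace_iff, Submodule.mem_span_singleton]
  constructor
  · intro hx
    have hx' : C *ᵥ x.ofLp = z j • x.ofLp := by simpa using congrArg WithLp.ofLp hx
    exact ⟨_, congrArg (WithLp.toLp 2) (h.eq_smul_col_of_mulVec_eq_smul hinj hx').symm⟩
  · rintro ⟨a, rfl⟩
    rw [map_smul, Matrix.toLpLin_toLp, Matrix.toLin'_apply, h.mulVec_col, WithLp.toLp_smul,
      smul_comm]

end IsUnitaryDiagonalization

end UnitaryDiagonalization

section SpectralMass

variable {n : ℕ} {ι : Type*} [Fintype ι] [DecidableEq ι] {C : Matrix (Fin n) (Fin n) ℂ} {z : ι → ℂ}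
  {V : Matrix (Fin n) ι ℂ}

theorem inner_e1 (hn : 0 < n) (x : EuclideanSpace ℂ (Fin n)) :
    inner ℂ x (e1 n) = conj (x ⟨0, hn⟩) := by
  rw [EuclideanSpace.inner_eq_star_dotProduct, dotProduct, Fintype.sum_eq_single ⟨0, hn⟩]
  · simp [e1]
  · rintro ⟨i, hi⟩ hi0
    simp only [ne_eq, Fin.mk.injEq] at hi0
    simp [e1, hi0]

theorem IsUnitaryDiagonalization.spectralMass_eq (h : IsUnitaryDiagonalization C z V)
    (hinj : Function.Injective z) (hn : 0 < n) (j : ι) :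
    spectralMass C (z j) = ‖V ⟨0, hn⟩ j‖ ^ 2 := by
  have hunit : ‖WithLp.toLp 2 (V.col j)‖ = 1 := by
    rw [← pow_eq_one_iff_of_nonneg (norm_nonneg _) two_ne_zero]
    have hinner := h.star_col_dotProduct_col j
    rw [dotProduct_comm, ← EuclideanSpace.inner_toLp_toLp, inner_self_eq_norm_sq_to_K] at hinner
    exact Complex.ofReal_injective (by simpa using hinner)
  simp only [spectralMass, h.eigenspace_eq_span hinj j,
    Submodule.starProjection_unit_singleton ℂ hunit, norm_smul, hunit, mul_one, inner_e1 hn,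
    RCLike.norm_conj, Matrix.col_apply]

theorem spectralMass_pos {w : ℂ} (hn : 0 < n) {v : Fin n → ℂ} (hv : C *ᵥ v = w • v)
    (hv0 : v ⟨0, hn⟩ ≠ 0) : 0 < spectralMass C w := by
  refine pow_pos (norm_pos_iff.2 fun hproj => hv0 ?_) 2
  rw [Submodule.starProjection_apply_eq_zero_iff, Submodule.mem_orthogonal] at hproj
  have hmem : WithLp.toLp 2 v ∈ Module.End.eigenspace (Matrix.toEuclideanLin C) w := by
    rw [Module.End.mem_eigenspace_iff, Matrix.toLpLin_toLp, Matrix.toLin'_apply, hv,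
      WithLp.toLp_smul]
  simpa [inner_e1 hn] using hproj _ hmem

theorem spectralMass_cmv_pos {α : ℕ → ℂ} (hα : IsVerblunsky n α) (hn : 0 < n) {w : ℂ}
    (hw : w ∈ spectrum ℂ (cmv n α)) : 0 < spectralMass (cmv n α) w := by
  obtain ⟨v, hv, hunit⟩ := exists_unit_eigenvector hw
  have hw0 : w ≠ 0 := norm_ne_zero_iff.1
    (norm_eq_one_of_mem_spectrum (cmv_mem_unitaryGroup hα) hw ▸ one_ne_zero)
  exact spectralMass_pos hn hv (eigenvector_zero_ne_zero hn hα hw0 hv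
    (by rintro rfl; simp at hunit))

theorem IsUnitaryDiagonalization.shifted_eq_heineMean {ι : Type*} [Fintype ι] [LinearOrder ι]
    {z : ι → ℂ} {V : Matrix (Fin n) ι ℂ} {α : ℕ → ℂ}
    (h : IsUnitaryDiagonalization (cmv n α) z V) (hα : IsVerblunsky n α) (hn : 0 < n)
    (hz : ∀ j, ‖z j‖ = 1) {k : ℕ} (hk : k ≤ n) :
    shifted α k = (-1) ^ (k + 1) *
      heineMean Finset.univ z (fun j => ‖V ⟨0, hn⟩ j‖ ^ 2) k := by
  obtain ⟨c, hc⟩ := exists_norm_det_eigenvectors_eq hα hn hk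
  let W : Matrix (Fin k) ι ℂ := V.submatrix (Fin.castLE hk) id
  have hW : W * Wᴴ = 1 := by
    rw [Matrix.conjTranspose_submatrix, ← Matrix.submatrix_mul _ _ _ _ _ Function.bijective_id,
      h.mul_conjTranspose, Matrix.submatrix_one _ (Fin.castLE_injective hk)]
  have hcorner : W * Matrix.diagonal (fun j => conj (z j)) * Wᴴ = (cmv k α)ᴴ := by
    rw [← cmv_submatrix_castLE hk, h.eq_mul_diagonal_mul]
    ext i j
    simp [W, Matrix.mul_apply, Matrix.diagonal_apply, mul_comm, mul_left_comm]
  have hminor (e : Fin k ↪o ι) : ‖(W.submatrix id e).det‖ ^ 2 =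
      c * heineWeight z (fun j => ‖V ⟨0, hn⟩ j‖ ^ 2) (Finset.univ.map e.toEmbedding) := by
    rw [heineWeight_map_univ]
    refine hc (z ∘ e) (V.submatrix id e) (fun j => hz (e j)) ?_
    ext i j
    exact (congrFun (congrFun h.mul_eq i) (e j)).trans (by simp only [Matrix.mul_diagonal]; rfl)
  rw [shifted_eq_det_conjTranspose_cmv hα hk, ← hcorner, det_eq_centerMass_heineWeight hW hminor,
    heineMean]

section Finset

variable {κ : Type*} {s : Finset κ} {z : κ → ℂ}

theorem exists_isUnitaryDiagonalization_of_finset [DecidableEq κ]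
    (hC : C ∈ Matrix.unitaryGroup (Fin n) ℂ) (hcard : s.card = n) (hinj : Set.InjOn z s)
    (hz : ∀ j ∈ s, z j ∈ spectrum ℂ C) :
    ∃ V : Matrix (Fin n) s ℂ, IsUnitaryDiagonalization C (fun j : s => z j) V :=
  exists_isUnitaryDiagonalization hC (by simpa using hcard) (Set.injOn_iff_injective.1 hinj)
    fun j => hz j j.2

theorem aeval_apply_zero_zero (hC : C ∈ Matrix.unitaryGroup (Fin n) ℂ) (hn : 0 < n)
    (hcard : s.card = n) (hinj : Set.InjOn z s) (hz : ∀ j ∈ s, z j ∈ spectrum ℂ C)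
    (p : Polynomial ℂ) :
    Polynomial.aeval C p ⟨0, hn⟩ ⟨0, hn⟩ = ∑ j ∈ s, spectralMass C (z j) * p.eval (z j) := by
  classical
  obtain ⟨V, hV⟩ := exists_isUnitaryDiagonalization_of_finset hC hcard hinj hz
  rw [(hV.aeval p).apply_self, ← Finset.sum_coe_sort s]
  refine Finset.sum_congr rfl fun j _ => ?_
  rw [hV.spectralMass_eq (Set.injOn_iff_injective.1 hinj) hn j, Complex.ofReal_pow]

theorem aeval_mul_lagrangeBasis_apply_zero_zero [DecidableEq κ]
    (hC : C ∈ Matrix.unitaryGroup (Fin n) ℂ) (hn : 0 < n) (hcard : s.card = n)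
    (hinj : Set.InjOn z s) (hz : ∀ j ∈ s, z j ∈ spectrum ℂ C) {j : κ} (hj : j ∈ s)
    (p : Polynomial ℂ) :
    Polynomial.aeval C (p * Lagrange.basis s z j) ⟨0, hn⟩ ⟨0, hn⟩ =
      spectralMass C (z j) * p.eval (z j) := by
  rw [aeval_apply_zero_zero hC hn hcard hinj hz, Finset.sum_eq_single_of_mem j hj,
    Polynomial.eval_mul, Lagrange.eval_basis_self hinj hj, mul_one]
  intro l hl hlj
  rw [Polynomial.eval_mul, Lagrange.eval_basis_of_ne hlj.symm hl, mul_zero, mul_zero]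

theorem conjTranspose_aeval_lagrangeBasis [DecidableEq κ]
    (hC : C ∈ Matrix.unitaryGroup (Fin n) ℂ) (hcard : s.card = n) (hinj : Set.InjOn z s)
    (hz : ∀ j ∈ s, z j ∈ spectrum ℂ C) {j : κ} (hj : j ∈ s) :
    (Polynomial.aeval C (Lagrange.basis s z j))ᴴ =
      Polynomial.aeval C (Lagrange.basis s z j) := by
  obtain ⟨V, hV⟩ := exists_isUnitaryDiagonalization_of_finset hC hcard hinj hz
  refine (hV.aeval _).conjTranspose_eq fun l => ?_
  obtain hlj | hlj := eq_or_ne j l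
  · simp only [← hlj, Lagrange.eval_basis_self hinj hj, map_one]
  · simp only [Lagrange.eval_basis_of_ne hlj l.2, map_zero]

theorem shifted_eq_heineMean [LinearOrder κ] {α : ℕ → ℂ} (hα : IsVerblunsky n α) (hn : 0 < n)
    (hcard : s.card = n) (hinj : Set.InjOn z s) (hz : ∀ j ∈ s, z j ∈ spectrum ℂ (cmv n α))
    {k : ℕ} (hk : k ≤ n) :
    shifted α k = (-1) ^ (k + 1) *
      heineMean s z (fun j => spectralMass (cmv n α) (z j)) k := by
  have hC := cmv_mem_unitaryGroup hα
  obtain ⟨V, hV⟩ := exists_isUnitaryDiagonalization_of_finset hC hcard hinj hz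
  rw [hV.shifted_eq_heineMean hα hn (fun j => norm_eq_one_of_mem_spectrum hC (hz j j.2)) hk]
  conv_rhs => rw [← Finset.attach_map_val (s := s), heineMean_map]
  simp only [← hV.spectralMass_eq (Set.injOn_iff_injective.1 hinj) hn]
  rfl

end Finset

end SpectralMass

section Calculus

theorem hasDerivAt_aeval_of_lax {R 𝔸 : Type*} [CommSemiring R] [NormedRing 𝔸] [NormedAlgebra ℝ 𝔸]
    [Algebra R 𝔸] {M : ℝ → 𝔸} {a : 𝔸} {t : ℝ} (hM : HasDerivAt M (a * M t - M t * a) t)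
    (p : Polynomial R) :
    HasDerivAt (fun s => Polynomial.aeval (M s) p)
      (a * Polynomial.aeval (M t) p - Polynomial.aeval (M t) p * a) t := by
  induction p using Polynomial.induction_on with
  | C c =>
    simp only [Polynomial.aeval_C, Algebra.commutes, sub_self]
    exact hasDerivAt_const t _
  | add p q hp hq =>
    simp only [map_add]
    exact (hp.fun_add hq).congr_deriv (by noncomm_ring)
  | monomial k c ih =>
    simp only [pow_succ, ← mul_assoc, map_mul _ (_ * _) Polynomial.X, Polynomial.aeval_X] at ih ⊢
    exact (ih.fun_mul hM).congr_deriv (by noncomm_ring)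

open scoped Matrix.Norms.Operator

variable {m : Type*} {M : ℝ → Matrix m m ℂ} {M' : Matrix m m ℂ} {t : ℝ}

theorem hasDerivAt_matrix_iff [Finite m] :
    HasDerivAt M M' t ↔ ∀ i j, HasDerivAt (fun s => M s i j) (M' i j) t := by
  have := Fintype.ofFinite m
  exact hasDerivAt_pi.trans (forall_congr' fun _ => hasDerivAt_pi)

theorem hasDerivAt_conjTranspose [Finite m] (hM : HasDerivAt M M' t) :
    HasDerivAt (fun s => (M s)ᴴ) M'ᴴ t :=
  hasDerivAt_matrix_iff.2 fun i j => (hasDerivAt_matrix_iff.1 hM j i).star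

theorem hasDerivAt_trace [Fintype m] (hM : HasDerivAt M M' t) :
    HasDerivAt (fun s => (M s).trace) M'.trace t :=
  HasDerivAt.fun_sum fun i _ => hasDerivAt_matrix_iff.1 hM i i

theorem hasDerivAt_trace_aeval [Fintype m] [DecidableEq m] (hM : HasDerivAt M M' t)
    (p : Polynomial ℂ) :
    HasDerivAt (fun s => (Polynomial.aeval (M s) p).trace)
      (Polynomial.aeval (M t) p.derivative * M').trace t := by
  induction p using Polynomial.induction_on' with
  | add p q hp hq =>
    simp only [map_add, Matrix.trace_add, Matrix.add_mul]
    exact hp.add hq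
  | monomial k a =>
    have hcyclic (i : ℕ) (hi : i ∈ Finset.range k) :
        (M t ^ (k.pred - i) * M' * M t ^ i).trace = (M t ^ (k - 1) * M').trace := by
      rw [Matrix.trace_mul_cycle, ← pow_add, Nat.pred_eq_sub_one,
        Nat.add_sub_cancel' (Nat.le_sub_one_of_lt (Finset.mem_range.1 hi))]
    simp only [Polynomial.aeval_monomial, Polynomial.derivative_monomial, ← Algebra.smul_def,
      Matrix.smul_mul, Matrix.trace_smul]
    refine ((hasDerivAt_trace (hM.fun_pow' k)).const_smul a).congr_deriv ?_
    rw [Matrix.trace_sum, Finset.sum_congr rfl hcyclic, Finset.sum_const, Finset.card_range,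
      mul_smul, Nat.cast_smul_eq_nsmul]

end Calculus

section Gradient

open scoped Matrix.Norms.Operator

variable {n : ℕ}

theorem lineDeriv_hamiltonian (f : Polynomial ℂ) (B V : Matrix (Fin n) (Fin n) ℂ) :
    lineDeriv ℝ (hamiltonian n f) B V = (Polynomial.aeval B f.derivative * V).trace.im := by
  have hline : HasDerivAt (fun s : ℝ => B + s • V) V 0 :=
    (((hasDerivAt_id (0 : ℝ)).smul_const V).const_add B).congr_deriv (one_smul ℝ V)
  have htrace := hasDerivAt_trace_aeval hline f
  rw [zero_smul, add_zero] at htrace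
  exact (Complex.imCLM.hasFDerivAt.comp_hasDerivAt 0 htrace).deriv

theorem grad_hamiltonian (f : Polynomial ℂ) (B : Matrix (Fin n) (Fin n) ℂ) :
    grad (hamiltonian n f) B = Polynomial.aeval B f.derivative := by
  ext k l
  simp only [grad, Matrix.of_apply, lineDeriv_hamiltonian, Matrix.trace_mul_single, op_smul_eq_mul]
  apply Complex.ext <;> simp

theorem isLinearMap_pairing (Y : Matrix (Fin n) (Fin n) ℂ) : IsLinearMap ℝ (pairing Y) where
  map_add := by simp [pairing, Matrix.mul_add]
  map_smul := by simp [pairing]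

theorem hasFDerivAt_pairing (Y B : Matrix (Fin n) (Fin n) ℂ) :
    HasFDerivAt (pairing Y) (LinearMap.toContinuousLinearMap (isLinearMap_pairing Y).mk') B :=
  (LinearMap.toContinuousLinearMap (isLinearMap_pairing Y).mk').hasFDerivAt

theorem grad_pairing (Y B : Matrix (Fin n) (Fin n) ℂ) : grad (pairing Y) B = Y := by
  have hderiv (V : Matrix (Fin n) (Fin n) ℂ) : lineDeriv ℝ (pairing Y) B V = pairing Y V :=
    ((hasFDerivAt_pairing Y B).hasLineDerivAt V).lineDeriv
  ext k l
  simp only [grad, Matrix.of_apply, hderiv, pairing, Matrix.trace_mul_single, op_smul_eq_mul]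
  apply Complex.ext <;> simp

/-- The anti-Hermitian half of the Lax pair of the flow generated by `Im tr f`. -/
noncomputable def laxMatrix (f : Polynomial ℂ) (B : Matrix (Fin n) (Fin n) ℂ) :
    Matrix (Fin n) (Fin n) ℂ :=
  projA (B * Polynomial.aeval B f.derivative)

theorem bracket_hamiltonian (f : Polynomial ℂ) (ψ : Matrix (Fin n) (Fin n) ℂ → ℝ)
    (B : Matrix (Fin n) (Fin n) ℂ) :
    bracket (hamiltonian n f) ψ B =
      pairing (grad ψ B) (laxMatrix f B * B - B * laxMatrix f B) := by
  let X := B * Polynomial.aeval B f.derivative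
  let g := grad ψ B
  have hcomm : Polynomial.aeval B f.derivative * B = X := by
    simpa only [map_mul, Polynomial.aeval_X] using
      congrArg (Polynomial.aeval B) (mul_comm f.derivative Polynomial.X)
  have hX : X * B = B * X := (Matrix.mul_assoc _ _ _).trans (congrArg (B * ·) hcomm)
  have hR : R X = X - (2 : ℂ) • laxMatrix f B := by
    rw [R, projL, laxMatrix, two_smul]
    abel
  have hleft : (R X * (g * B)).trace =
      (g * (B * X)).trace - 2 * (g * (B * laxMatrix f B)).trace := by
    rw [Matrix.trace_mul_comm, hR, Matrix.mul_sub, Matrix.mul_smul, Matrix.trace_sub,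
      Matrix.trace_smul, smul_eq_mul, Matrix.mul_assoc, Matrix.mul_assoc]
  have hright : (R X * (B * g)).trace =
      (g * (B * X)).trace - 2 * (g * (laxMatrix f B * B)).trace := by
    rw [← Matrix.mul_assoc, Matrix.trace_mul_comm, hR, Matrix.sub_mul, Matrix.smul_mul,
      Matrix.mul_sub, Matrix.mul_smul, Matrix.trace_sub, Matrix.trace_smul, smul_eq_mul, hX]
  rw [bracket, grad_hamiltonian, hcomm, pairing, pairing, hleft, hright, pairing, Matrix.mul_sub,
    Matrix.trace_sub]
  simp only [Complex.sub_im, Complex.mul_im, Complex.re_ofNat, Complex.im_ofNat]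
  ring

theorem IsFlow.hasDerivAt {f : Polynomial ℂ} {B : ℝ → Matrix (Fin n) (Fin n) ℂ}
    (h : IsFlow (hamiltonian n f) B) (t : ℝ) :
    HasDerivAt B (laxMatrix f (B t) * B t - B t * laxMatrix f (B t)) t := by
  refine hasDerivAt_matrix_iff.2 fun i j => ?_
  have hpairing (Y : Matrix (Fin n) (Fin n) ℂ) :=
    h (pairing Y) (fun B => (hasFDerivAt_pairing Y B).differentiableAt) t
  simp only [bracket_hamiltonian, grad_pairing] at hpairing
  have him := hpairing (Matrix.single j i 1)
  have hre := hpairing (Matrix.single j i Complex.I)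
  simp only [pairing, Matrix.trace_single_mul, smul_eq_mul, one_mul, Complex.I_mul_im] at him hre
  simpa only [Complex.re_add_im] using hre.ofReal_comp.fun_add (him.ofReal_comp.mul_const Complex.I)

end Gradient

section Isospectrality

variable {n : ℕ}

theorem conjTranspose_projA (X : Matrix (Fin n) (Fin n) ℂ) : (projA X)ᴴ = -projA X := by
  ext i j
  obtain h | rfl | h := lt_trichotomy i j
  · simp [projA, h, h.not_gt, h.ne']
  · simp [projA]
  · simp [projA, h, h.not_gt, h.ne']

open scoped Matrix.Norms.Operator ComplexOrder in
theorem IsFlow.aeval_eq_zero_iff {f : Polynomial ℂ} {B : ℝ → Matrix (Fin n) (Fin n) ℂ}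
    (h : IsFlow (hamiltonian n f) B) (p : Polynomial ℂ) (t t' : ℝ) :
    Polynomial.aeval (B t) p = 0 ↔ Polynomial.aeval (B t') p = 0 := by
  have hconst (t : ℝ) : HasDerivAt
      (fun s => ((Polynomial.aeval (B s) p)ᴴ * Polynomial.aeval (B s) p).trace) 0 t := by
    have hY := hasDerivAt_aeval_of_lax (h.hasDerivAt t) p
    refine (hasDerivAt_trace ((hasDerivAt_conjTranspose hY).fun_mul hY)).congr_deriv ?_
    generalize Polynomial.aeval (B t) p = Y
    have hlax : (laxMatrix f (B t))ᴴ = -laxMatrix f (B t) := conjTranspose_projA _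
    generalize laxMatrix f (B t) = A at hlax
    calc ((A * Y - Y * A)ᴴ * Y + Yᴴ * (A * Y - Y * A)).trace
        = (A * (Yᴴ * Y) - Yᴴ * Y * A).trace := by
          rw [Matrix.conjTranspose_sub, Matrix.conjTranspose_mul, Matrix.conjTranspose_mul, hlax]
          noncomm_ring
      _ = 0 := by rw [Matrix.trace_sub, Matrix.trace_mul_comm, sub_self]
  rw [← Matrix.trace_conjTranspose_mul_self_eq_zero_iff,
    is_const_of_deriv_eq_zero (fun t => (hconst t).differentiableAt) (fun t => (hconst t).deriv)
      t t', Matrix.trace_conjTranspose_mul_self_eq_zero_iff]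

theorem spectrum_subset_of_aeval_eq_zero {K m : Type*} [Field K] [Fintype m] [DecidableEq m]
    {C D : Matrix m m K}
    (h : ∀ p : Polynomial K, Polynomial.aeval D p = 0 → Polynomial.aeval C p = 0) :
    spectrum K C ⊆ spectrum K D := by
  intro w hw
  have : Nontrivial (Matrix m m K) := by
    by_contra htrivial
    rw [not_nontrivial_iff_subsingleton] at htrivial
    simp [spectrum.of_subsingleton] at hw
  have hroot := spectrum.subset_polynomial_aeval C (minpoly K D) (Set.mem_image_of_mem _ hw)
  rw [h _ (minpoly.aeval K D), spectrum.zero_eq, Set.mem_singleton_iff] at hroot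
  rw [← Matrix.spectrum_toLin', ← Module.End.hasEigenvalue_iff_mem_spectrum]
  apply Module.End.hasEigenvalue_of_isRoot
  rwa [Matrix.minpoly_toLin']

theorem IsFlow.spectrum_eq {f : Polynomial ℂ} {B : ℝ → Matrix (Fin n) (Fin n) ℂ}
    (h : IsFlow (hamiltonian n f) B) (t t' : ℝ) : spectrum ℂ (B t) = spectrum ℂ (B t') :=
  (spectrum_subset_of_aeval_eq_zero fun p => (h.aeval_eq_zero_iff p t t').2).antisymm
    (spectrum_subset_of_aeval_eq_zero fun p => (h.aeval_eq_zero_iff p t t').1)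

end Isospectrality

section MassEvolution

variable {n : ℕ}

theorem projA_commutator_apply_zero_zero (hn : 0 < n) (X Y : Matrix (Fin n) (Fin n) ℂ) :
    (projA X * Y - Y * projA X) ⟨0, hn⟩ ⟨0, hn⟩ =
      (X * Y + Y * Xᴴ) ⟨0, hn⟩ ⟨0, hn⟩ -
        2 * (X ⟨0, hn⟩ ⟨0, hn⟩).re * Y ⟨0, hn⟩ ⟨0, hn⟩ := by
  let o : Fin n := ⟨0, hn⟩
  have hpos {l : Fin n} (hl : l ≠ o) : o < l :=
    Fin.lt_def.2 (Nat.pos_of_ne_zero fun h => hl (Fin.ext h))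
  have hrow (l : Fin n) : projA X o l = X o l - if l = o then ((X o o).re : ℂ) else 0 := by
    obtain rfl | hl := eq_or_ne l o
    · apply Complex.ext <;> simp [projA]
    · simp [projA, hpos hl, hl]
  have hcol (l : Fin n) : projA X l o = -Xᴴ l o + if l = o then ((X o o).re : ℂ) else 0 := by
    obtain rfl | hl := eq_or_ne l o
    · apply Complex.ext <;> simp [projA]
    · simp [projA, (hpos hl).not_gt, hl]
  change (projA X * Y - Y * projA X) o o = (X * Y + Y * Xᴴ) o o - 2 * (X o o).re * Y o o
  simp only [Matrix.sub_apply, Matrix.add_apply, Matrix.mul_apply, hrow, hcol, sub_mul, mul_add,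
    mul_neg, Finset.sum_sub_distrib, Finset.sum_add_distrib, Finset.sum_neg_distrib, ite_mul,
    mul_ite, zero_mul, mul_zero, Finset.sum_ite_eq', Finset.mem_univ, if_true]
  ring

open scoped Matrix.Norms.Operator in
theorem IsFlow.hasDerivAt_spectralMass {κ : Type*} {f : Polynomial ℂ}
    {B : ℝ → Matrix (Fin n) (Fin n) ℂ} (h : IsFlow (hamiltonian n f) B)
    (hB : ∀ t, B t ∈ Matrix.unitaryGroup (Fin n) ℂ) (hn : 0 < n) {s : Finset κ} {z : κ → ℂ}
    (hcard : s.card = n) (hinj : Set.InjOn z s) (hz : ∀ t, ∀ j ∈ s, z j ∈ spectrum ℂ (B t))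
    {j : κ} (hj : j ∈ s) (t : ℝ) :
    HasDerivAt (fun t => spectralMass (B t) (z j))
      ((speed f (z j) -
          2 * ((B t * Polynomial.aeval (B t) f.derivative) ⟨0, hn⟩ ⟨0, hn⟩).re) *
        spectralMass (B t) (z j)) t := by
  classical
  let o : Fin n := ⟨0, hn⟩
  let X := B t * Polynomial.aeval (B t) f.derivative
  let Y (t : ℝ) := Polynomial.aeval (B t) (Lagrange.basis s z j)
  have hY (t : ℝ) : Y t o o = spectralMass (B t) (z j) := by
    simpa using aeval_mul_lagrangeBasis_apply_zero_zero (hB t) hn hcard hinj (hz t) hj 1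
  have hYH : (Y t)ᴴ = Y t := conjTranspose_aeval_lagrangeBasis (hB t) hcard hinj (hz t) hj
  have hXY : (X * Y t) o o = spectralMass (B t) (z j) * (z j * f.derivative.eval (z j)) := by
    have hcorner := aeval_mul_lagrangeBasis_apply_zero_zero (hB t) hn hcard hinj (hz t) hj
      (Polynomial.X * f.derivative)
    rwa [map_mul, map_mul, Polynomial.aeval_X, Polynomial.eval_mul, Polynomial.eval_X] at hcorner
  have hYX : (Y t * Xᴴ) o o = conj ((X * Y t) o o) := by
    rw [← Complex.star_def, ← Matrix.conjTranspose_apply, Matrix.conjTranspose_mul X, hYH]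
  have hmass (t : ℝ) : spectralMass (B t) (z j) = (Y t o o).re := by
    rw [hY, Complex.ofReal_re]
  have hlax : HasDerivAt (fun t => Y t o o) ((projA X * Y t - Y t * projA X) o o) t :=
    hasDerivAt_matrix_iff.1 (hasDerivAt_aeval_of_lax (h.hasDerivAt t) _) o o
  rw [projA_commutator_apply_zero_zero hn, Matrix.add_apply, hYX, hXY, hY] at hlax
  simp_rw [hmass]
  refine (Complex.reCLM.hasFDerivAt.comp_hasDerivAt t hlax).congr_deriv ?_
  simp only [Complex.reCLM_apply, Complex.sub_re, Complex.add_re, Complex.conj_re,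
    Complex.re_ofReal_mul, ← Complex.ofReal_ofNat, mul_assoc, Complex.ofReal_re, ← hmass, speed, X]
  ring

theorem exists_eq_mul_exp_of_hasDerivAt {κ : Type*} {s : Finset κ} {m : κ → ℝ → ℝ} {lam : κ → ℝ}
    {c : ℝ → ℝ} (hm : ∀ j ∈ s, ∀ t, m j t ≠ 0)
    (hderiv : ∀ j ∈ s, ∀ t, HasDerivAt (m j) ((lam j - c t) * m j t) t) (t : ℝ) :
    ∃ g ≠ 0, ∀ j ∈ s, m j t = g * (m j 0 * Real.exp (lam j * t)) := by
  obtain rfl | ⟨i, hi⟩ := s.eq_empty_or_nonempty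
  · exact ⟨1, one_ne_zero, by simp⟩
  have hexp (j : κ) (t : ℝ) : HasDerivAt (fun t => Real.exp (lam j * t))
      (Real.exp (lam j * t) * lam j) t := by
    simpa using ((hasDerivAt_id t).const_mul (lam j)).exp
  let r (j : κ) (t : ℝ) := m j t / Real.exp (lam j * t)
  have hr (j : κ) (hj : j ∈ s) (t : ℝ) : HasDerivAt (r j) (-c t * r j t) t :=
    ((hderiv j hj t).fun_div (hexp j t) (Real.exp_ne_zero _)).congr_deriv
      (by simp only [r]; field_simp; ring)
  have hr0 (t : ℝ) : r i t ≠ 0 := div_ne_zero (hm i hi t) (Real.exp_ne_zero _)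
  refine ⟨r i t / r i 0, div_ne_zero (hr0 t) (hr0 0), fun j hj => ?_⟩
  have hratio (t : ℝ) : HasDerivAt (fun t => r j t / r i t) 0 t :=
    ((hr j hj t).fun_div (hr i hi t) (hr0 t)).congr_deriv (by ring)
  have hconst := is_const_of_deriv_eq_zero (fun t => (hratio t).differentiableAt)
    (fun t => (hratio t).deriv) t 0
  rw [div_eq_div_iff (hr0 t) (hr0 0)] at hconst
  have hj0 : r j 0 = m j 0 := by simp [r]
  rw [div_mul_eq_mul_div, eq_div_iff (hr0 0), ← mul_assoc, mul_comm (r i t), ← hj0, ← hconst]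
  simp only [r]
  field_simp

end MassEvolution

section Evolution

variable {n : ℕ} {κ : Type*} [LinearOrder κ] {f : Polynomial ℂ} {α : ℝ → ℕ → ℂ} {s : Finset κ}
  {z : κ → ℂ}

theorem shifted_flow_eq_heineMean (h : IsFlow (hamiltonian n f) fun t => cmv n (α t))
    (hα : ∀ t, IsVerblunsky n (α t)) (hn : 0 < n) (hcard : s.card = n) (hinj : Set.InjOn z s)
    (hz : ∀ j ∈ s, z j ∈ spectrum ℂ (cmv n (α 0))) {k : ℕ} (hk : k ≤ n) (t : ℝ) :
    shifted (α t) k = (-1) ^ (k + 1) *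
      heineMean s z (fun j => spectralMass (cmv n (α 0)) (z j) * Real.exp (speed f (z j) * t))
        k := by
  have hz' (t : ℝ) (j : κ) (hj : j ∈ s) : z j ∈ spectrum ℂ (cmv n (α t)) :=
    h.spectrum_eq 0 t ▸ hz j hj
  obtain ⟨g, hg, hmass⟩ := exists_eq_mul_exp_of_hasDerivAt
    (m := fun j t => spectralMass (cmv n (α t)) (z j))
    (fun j hj t => (spectralMass_cmv_pos (hα t) hn (hz' t j hj)).ne')
    (fun j hj t => h.hasDerivAt_spectralMass (fun t => cmv_mem_unitaryGroup (hα t)) hn hcard hinj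
      hz' hj t) t
  rw [shifted_eq_heineMean (hα t) hn hcard hinj (hz' t) hk, heineMean_congr hmass,
    heineMean_const_mul hg]

end Evolution

section VerblunskyLimit

variable {κ : Type*} {z : κ → ℂ} {S T : Finset κ}

/-- The limit of `shifted (α t) #S` when the eigenvalues `z j`, `j ∈ S`, dominate the others. -/
noncomputable def verblunskyLimit (z : κ → ℂ) (S : Finset κ) : ℂ :=
  (-1) ^ (S.card + 1) * ∏ j ∈ S, conj (z j)

theorem verblunskyLimit_ne_zero (hz : ∀ j ∈ S, ‖z j‖ = 1) : verblunskyLimit z S ≠ 0 := by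
  refine mul_ne_zero (pow_ne_zero _ (neg_ne_zero.2 one_ne_zero))
    (Finset.prod_ne_zero_iff.2 fun j hj => ?_)
  rw [← norm_ne_zero_iff, RCLike.norm_conj, hz j hj]
  exact one_ne_zero

theorem verblunskyLimit_union [DecidableEq κ] (h : Disjoint S T) :
    verblunskyLimit z (S ∪ T) = -(verblunskyLimit z S * verblunskyLimit z T) := by
  rw [verblunskyLimit, verblunskyLimit, verblunskyLimit, Finset.card_union_of_disjoint h,
    Finset.prod_union h]
  ring

theorem eq_neg_verblunskyLimit_div_insert [DecidableEq κ] {j : κ} (hj : j ∉ S)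
    (hz : ∀ l ∈ insert j S, ‖z l‖ = 1) :
    z j = -(verblunskyLimit z S / verblunskyLimit z (insert j S)) := by
  have hinsert : verblunskyLimit z (insert j S) = -(conj (z j) * verblunskyLimit z S) := by
    rw [verblunskyLimit, verblunskyLimit, Finset.card_insert_of_notMem hj,
      Finset.prod_insert hj]
    ring
  have hzj : z j * conj (z j) = 1 := by
    rw [Complex.mul_conj', hz j (Finset.mem_insert_self j S)]
    simp
  rw [← neg_div, eq_div_iff (verblunskyLimit_ne_zero hz), hinsert]
  linear_combination -verblunskyLimit z S * hzj

end VerblunskyLimit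

section OrderedSolution

/-- `t ↦ α t` is a global solution of the flow of `Im tr f`, the eigenvalues of its CMV matrices
are enumerated as `z 1, …, z n` in the order of decreasing speed, and `μ j` is the initial
spectral mass of `z j`. -/
structure IsOrderedSolution (n : ℕ) (f : Polynomial ℂ) (α : ℝ → ℕ → ℂ) (z : ℕ → ℂ) (μ : ℕ → ℝ) :
    Prop where
  pos : 0 < n
  isVerblunsky : ∀ t, IsVerblunsky n (α t)
  isFlow : IsFlow (hamiltonian n f) fun t => cmv n (α t)
  spectrum_zero : spectrum ℂ (cmv n (α 0)) = z '' Set.Icc 1 n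
  strictAntiOn : StrictAntiOn (fun j => speed f (z j)) (Set.Icc 1 n)
  mass_eq : ∀ j, μ j = spectralMass (cmv n (α 0)) (z j)

namespace IsOrderedSolution

variable {n : ℕ} {f : Polynomial ℂ} {α : ℝ → ℕ → ℂ} {z : ℕ → ℂ} {μ : ℕ → ℝ}

theorem injOn (h : IsOrderedSolution n f α z μ) : Set.InjOn z (Finset.Icc 1 n) :=
  fun i hi j hj hij => h.strictAntiOn.injOn (by simpa using hi) (by simpa using hj)
    (congrArg (speed f) hij)

theorem mem_spectrum (h : IsOrderedSolution n f α z μ) {j : ℕ} (hj : j ∈ Finset.Icc 1 n) :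
    z j ∈ spectrum ℂ (cmv n (α 0)) :=
  h.spectrum_zero ▸ Set.mem_image_of_mem z (Finset.mem_Icc.1 hj)

theorem spectrum_eq (h : IsOrderedSolution n f α z μ) (t : ℝ) :
    spectrum ℂ (cmv n (α t)) = z '' Set.Icc 1 n :=
  (h.isFlow.spectrum_eq t 0).trans h.spectrum_zero

theorem norm_eq_one (h : IsOrderedSolution n f α z μ) {j : ℕ} (hj : j ∈ Finset.Icc 1 n) :
    ‖z j‖ = 1 :=
  norm_eq_one_of_mem_spectrum (cmv_mem_unitaryGroup (h.isVerblunsky 0)) (h.mem_spectrum hj)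

theorem mass_pos (h : IsOrderedSolution n f α z μ) {j : ℕ} (hj : j ∈ Finset.Icc 1 n) : 0 < μ j :=
  h.mass_eq j ▸ spectralMass_cmv_pos (h.isVerblunsky 0) h.pos (h.mem_spectrum hj)

theorem speed_lt (h : IsOrderedSolution n f α z μ) {i j : ℕ} (hi : 1 ≤ i) (hij : i < j)
    (hj : j ≤ n) : speed f (z j) < speed f (z i) :=
  h.strictAntiOn ⟨hi, by omega⟩ ⟨by omega, hj⟩ hij

theorem shifted_eq (h : IsOrderedSolution n f α z μ) {k : ℕ} (hk : k ≤ n) (t : ℝ) :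
    shifted (α t) k = (-1) ^ (k + 1) *
      heineMean (Finset.Icc 1 n) z (fun j => μ j * Real.exp (speed f (z j) * t)) k := by
  simp only [h.mass_eq]
  exact shifted_flow_eq_heineMean h.isFlow h.isVerblunsky h.pos (by simp) h.injOn
    (fun j hj => h.mem_spectrum hj) hk t

theorem coefficient_eq (h : IsOrderedSolution n f α z μ) {k : ℕ} (hk : 1 ≤ k) (hkn : k ≤ n - 1)
    (t : ℝ) : α t (k - 1) = (-1) ^ (k - 1) *
      heineMean (Finset.Icc 1 n) z (fun j => μ j * Real.exp (speed f (z j) * t)) k := by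
  obtain ⟨k, rfl⟩ := Nat.exists_eq_add_of_le' hk
  rw [Nat.add_sub_cancel]
  refine (h.shifted_eq (k := k + 1) (by omega) t).trans ?_
  ring

theorem last_eq (h : IsOrderedSolution n f α z μ) (t : ℝ) :
    shifted (α t) n = verblunskyLimit z (Finset.Icc 1 n) := by
  have hheine := heineMean_card
    (fun j hj => mul_pos (h.mass_pos hj) (Real.exp_pos (speed f (z j) * t))) h.injOn
  rw [Nat.card_Icc, Nat.add_sub_cancel] at hheine
  rw [h.shifted_eq le_rfl, hheine, verblunskyLimit, Nat.card_Icc, Nat.add_sub_cancel]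

theorem tendsto_atTop (h : IsOrderedSolution n f α z μ) {m : ℕ} (hm : m ≤ n) :
    Filter.Tendsto (fun t => shifted (α t) m) Filter.atTop
      (𝓝 (verblunskyLimit z (Finset.Icc 1 m))) := by
  have hsub : Finset.Icc 1 m ⊆ Finset.Icc 1 n := Finset.Icc_subset_Icc le_rfl hm
  have hheine := tendsto_heineMean_atTop (lam := fun j => speed f (z j)) hsub
    (fun j hj => h.mass_pos (hsub hj)) (h.injOn.mono hsub) fun x hx y hy => by
      simp only [Finset.mem_sdiff, Finset.mem_Icc] at hx hy
      exact h.speed_lt hx.1 (by omega) hy.1.2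
  simp only [h.shifted_eq hm, verblunskyLimit]
  rw [Nat.card_Icc, Nat.add_sub_cancel] at hheine ⊢
  exact hheine.const_mul _

theorem tendsto_atBot (h : IsOrderedSolution n f α z μ) {m : ℕ} (hm : m ≤ n) :
    Filter.Tendsto (fun t => shifted (α t) m) Filter.atBot
      (𝓝 (verblunskyLimit z (Finset.Icc (n - m + 1) n))) := by
  have hsub : Finset.Icc (n - m + 1) n ⊆ Finset.Icc 1 n := Finset.Icc_subset_Icc (by omega) le_rfl
  have hcard : (Finset.Icc (n - m + 1) n).card = m := by
    rw [Nat.card_Icc]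
    omega
  have hheine := tendsto_heineMean_atBot (lam := fun j => speed f (z j)) hsub
    (fun j hj => h.mass_pos (hsub hj)) (h.injOn.mono hsub) fun x hx y hy => by
      simp only [Finset.mem_sdiff, Finset.mem_Icc] at hx hy
      exact h.speed_lt hy.1.1 (by omega) hx.2
  simp only [h.shifted_eq hm, verblunskyLimit]
  rw [hcard] at hheine ⊢
  exact hheine.const_mul _

theorem asymptotics_atTop (h : IsOrderedSolution n f α z μ) {k : ℕ} (hk : 1 ≤ k)
    (hkn : k ≤ n - 1) :
    ∃ γ : ℝ, 0 < speed f (z k) - speed f (z (k + 1)) ∧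
      speed f (z k) - speed f (z (k + 1)) < γ ∧
      (fun t : ℝ => α t (k - 1) - (-1) ^ (k - 1) * (∏ j ∈ Finset.Icc 1 k, conj (z j)) *
        (1 + xi z μ k * (Real.exp (-(speed f (z k) - speed f (z (k + 1))) * t) : ℂ)))
        =O[Filter.atTop] fun t : ℝ => Real.exp (-γ * t) := by
  have hspeed : speed f (z (k + 1)) < speed f (z k) := h.speed_lt hk (by omega) (by omega)
  have hP {x : ℕ} : x ∈ Finset.Icc 1 (k - 1) ↔ 1 ≤ x ∧ x < k := by
    rw [Finset.mem_Icc]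
    omega
  have hinsert : insert k (Finset.Icc 1 (k - 1)) = Finset.Icc 1 k := by
    ext x
    rw [Finset.mem_insert, hP, Finset.mem_Icc]
    omega
  have hcard : (Finset.Icc 1 (k - 1)).card + 1 = k := by
    rw [Nat.card_Icc]
    omega
  obtain ⟨γ, hγ, hO⟩ := heineMean_asymptotics_atTop (P := Finset.Icc 1 (k - 1))
    (lam := fun j => speed f (z j)) (a := k) (b := k + 1) (fun j hj => h.mass_pos hj) h.injOn
    (h.norm_eq_one (Finset.mem_Icc.2 ⟨hk, by omega⟩))
    (Finset.Icc_subset_Icc le_rfl (by omega)) (Finset.mem_Icc.2 ⟨hk, by omega⟩)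
    (Finset.mem_Icc.2 ⟨by omega, by omega⟩) (by rw [hP]; omega) (by rw [hP]; omega) hspeed
    (fun x hx => h.speed_lt (hP.1 hx).1 (hP.1 hx).2 (by omega)) fun y hy hyP hyk hyk' => by
      rw [hP] at hyP
      rw [Finset.mem_Icc] at hy
      exact h.speed_lt (by omega) (by omega) hy.2
  rw [hinsert, hcard] at hO
  refine ⟨γ, sub_pos.2 hspeed, hγ, (hO.const_mul_left ((-1) ^ (k - 1))).congr_left fun t => ?_⟩
  rw [h.coefficient_eq hk hkn, mul_sub, mul_assoc]
  rfl

theorem asymptotics_atBot (h : IsOrderedSolution n f α z μ) {k : ℕ} (hk : 1 ≤ k)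
    (hkn : k ≤ n - 1) :
    ∃ γ : ℝ, 0 < speed f (z (n - k)) - speed f (z (n - k + 1)) ∧
      speed f (z (n - k)) - speed f (z (n - k + 1)) < γ ∧
      (fun t : ℝ => α t (k - 1) - (-1) ^ (k - 1) *
        (∏ j ∈ Finset.Icc (n - k + 1) n, conj (z j)) *
        (1 + zeta n z μ k * (Real.exp ((speed f (z (n - k)) - speed f (z (n - k + 1))) * t) : ℂ)))
        =O[Filter.atBot] fun t : ℝ => Real.exp (γ * t) := by
  have hspeed : speed f (z (n - k + 1)) < speed f (z (n - k)) :=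
    h.speed_lt (by omega) (by omega) (by omega)
  have hP {x : ℕ} : x ∈ Finset.Icc (n - k + 2) n ↔ n - k + 1 < x ∧ x ≤ n := by
    rw [Finset.mem_Icc]
    omega
  have hinsert : insert (n - k + 1) (Finset.Icc (n - k + 2) n) = Finset.Icc (n - k + 1) n := by
    ext x
    rw [Finset.mem_insert, hP, Finset.mem_Icc]
    omega
  have hcard : (Finset.Icc (n - k + 2) n).card + 1 = k := by
    rw [Nat.card_Icc]
    omega
  obtain ⟨γ, hγ, hO⟩ := heineMean_asymptotics_atBot (P := Finset.Icc (n - k + 2) n)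
    (lam := fun j => speed f (z j)) (a := n - k + 1) (b := n - k) (fun j hj => h.mass_pos hj)
    h.injOn (h.norm_eq_one (Finset.mem_Icc.2 ⟨by omega, by omega⟩))
    (Finset.Icc_subset_Icc (by omega) le_rfl) (Finset.mem_Icc.2 ⟨by omega, by omega⟩)
    (Finset.mem_Icc.2 ⟨by omega, by omega⟩) (by rw [hP]; omega) (by rw [hP]; omega) hspeed
    (fun x hx => h.speed_lt (by omega) (hP.1 hx).1 (hP.1 hx).2) fun y hy hyP hyk hyk' => by
      rw [hP] at hyP
      rw [Finset.mem_Icc] at hy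
      exact h.speed_lt hy.1 (by omega) (by omega)
  rw [hinsert, hcard] at hO
  refine ⟨γ, sub_pos.2 hspeed, hγ, (hO.const_mul_left ((-1) ^ (k - 1))).congr_left fun t => ?_⟩
  rw [h.coefficient_eq hk hkn, mul_sub, mul_assoc]
  rfl

theorem xi_mul_zeta (h : IsOrderedSolution n f α z μ) {k : ℕ} (hk : 1 ≤ k) (hkn : k ≤ n - 1) :
    xi z μ k * zeta n z μ (n - k) =
      ((‖z (k + 1) - z k‖ ^ 2
        * (∏ l ∈ Finset.Icc 1 (k - 1), ‖(z (k + 1) - z l) / (z k - z l)‖ ^ 2)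
        * ∏ m ∈ Finset.Icc (k + 2) n, ‖(z k - z m) / (z (k + 1) - z m)‖ ^ 2 : ℝ) : ℂ) := by
  have hmem : k ∈ Finset.Icc 1 n := Finset.mem_Icc.2 ⟨hk, by omega⟩
  have hmem' : k + 1 ∈ Finset.Icc 1 n := Finset.mem_Icc.2 ⟨by omega, by omega⟩
  rw [zeta, Nat.sub_sub_self (by omega)]
  exact asymptoticConstant_mul_swap (h.norm_eq_one hmem) (h.mass_pos hmem).ne'
    (h.mass_pos hmem').ne' _ _

theorem limit_mul_limit (h : IsOrderedSolution n f α z μ) {k : ℕ} (hkn : k ≤ n) (t : ℝ) :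
    verblunskyLimit z (Finset.Icc 1 k) * verblunskyLimit z (Finset.Icc (n - (n - k) + 1) n) =
      -shifted (α t) n := by
  have hunion : Finset.Icc 1 k ∪ Finset.Icc (k + 1) n = Finset.Icc 1 n := by
    ext x
    simp only [Finset.mem_union, Finset.mem_Icc]
    omega
  have hdisjoint : Disjoint (Finset.Icc 1 k) (Finset.Icc (k + 1) n) := by
    rw [Finset.disjoint_left]
    intro x
    simp only [Finset.mem_Icc]
    omega
  rw [h.last_eq, Nat.sub_sub_self hkn, ← hunion, verblunskyLimit_union hdisjoint, neg_neg]

theorem limit_mul_limit_eq_prod (h : IsOrderedSolution n f α z μ) {k : ℕ} (hkn : k ≤ n) :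
    verblunskyLimit z (Finset.Icc 1 k) * verblunskyLimit z (Finset.Icc (n - (n - k) + 1) n) =
      (-1) ^ n * ∏ j ∈ Finset.Icc 1 n, conj (z j) := by
  rw [h.limit_mul_limit hkn 0, h.last_eq, verblunskyLimit, Nat.card_Icc, Nat.add_sub_cancel]
  ring

theorem limit_mul_limit_eq_det (h : IsOrderedSolution n f α z μ) {k : ℕ} (hkn : k ≤ n) (t : ℝ) :
    verblunskyLimit z (Finset.Icc 1 k) * verblunskyLimit z (Finset.Icc (n - (n - k) + 1) n) =
      (-1) ^ n * (cmv n (α t))ᴴ.det := by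
  rw [h.limit_mul_limit hkn t, shifted_eq_det_conjTranspose_cmv (h.isVerblunsky t) le_rfl]
  ring

theorem limit_mul_limit_eq_neg_last (h : IsOrderedSolution n f α z μ) {k : ℕ} (hkn : k ≤ n)
    (t : ℝ) :
    verblunskyLimit z (Finset.Icc 1 k) * verblunskyLimit z (Finset.Icc (n - (n - k) + 1) n) =
      -α t (n - 1) := by
  rw [h.limit_mul_limit hkn t]
  obtain ⟨m, rfl⟩ := Nat.exists_eq_add_of_le' h.pos
  rfl

theorem eigenvalue_eq (h : IsOrderedSolution n f α z μ) {j : ℕ} {S T : Finset ℕ} (hj : j ∉ S)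
    (hT : insert j S = T) (hTn : T ⊆ Finset.Icc 1 n) :
    verblunskyLimit z T ≠ 0 ∧ z j = -(verblunskyLimit z S / verblunskyLimit z T) := by
  subst hT
  have hnorm (l : ℕ) (hl : l ∈ insert j S) := h.norm_eq_one (hTn hl)
  exact ⟨verblunskyLimit_ne_zero hnorm, eq_neg_verblunskyLimit_div_insert hj hnorm⟩

theorem eigenvalue_eq_atTop (h : IsOrderedSolution n f α z μ) {j : ℕ} (hj : 1 ≤ j) (hjn : j ≤ n) :
    verblunskyLimit z (Finset.Icc 1 j) ≠ 0 ∧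
      z j = -(verblunskyLimit z (Finset.Icc 1 (j - 1)) / verblunskyLimit z (Finset.Icc 1 j)) := by
  refine h.eigenvalue_eq (by rw [Finset.mem_Icc]; omega) ?_ (Finset.Icc_subset_Icc le_rfl hjn)
  ext x
  simp only [Finset.mem_insert, Finset.mem_Icc]
  omega

theorem eigenvalue_eq_atBot (h : IsOrderedSolution n f α z μ) {j : ℕ} (hj : 1 ≤ j) (hjn : j ≤ n) :
    verblunskyLimit z (Finset.Icc (n - (n - j + 1) + 1) n) ≠ 0 ∧
      z j = -(verblunskyLimit z (Finset.Icc (n - (n - j) + 1) n) /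
        verblunskyLimit z (Finset.Icc (n - (n - j + 1) + 1) n)) := by
  refine h.eigenvalue_eq (by rw [Finset.mem_Icc]; omega) ?_
    (Finset.Icc_subset_Icc (by omega) le_rfl)
  ext x
  simp only [Finset.mem_insert, Finset.mem_Icc]
  omega

end IsOrderedSolution

end OrderedSolution

end CMV

theorem mainTheorem13 (n : ℕ) (hn : 1 ≤ n) (f : Polynomial ℂ)
    (α : ℝ → ℕ → ℂ) (hα : ∀ t, CMV.IsVerblunsky n (α t))
    (hflow : CMV.IsFlow (CMV.hamiltonian n f) (fun t => CMV.cmv n (α t)))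
    (z : ℕ → ℂ) (hz : spectrum ℂ (CMV.cmv n (α 0)) = z '' Set.Icc 1 n)
    (hlam : StrictAntiOn (fun j => CMV.speed f (z j)) (Set.Icc 1 n))
    (μ : ℕ → ℝ) (hμ : ∀ j, μ j = CMV.spectralMass (CMV.cmv n (α 0)) (z j)) :
    -- the eigenvalues are time independent
    (∀ t, spectrum ℂ (CMV.cmv n (α t)) = z '' Set.Icc 1 n) ∧
    -- the numbers `ξ_{k-1}`, `ζ_{k-1}` are the asymptotic constants at `+∞` and `-∞`
    (∀ k, 1 ≤ k → k ≤ n - 1 →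
      (∃ γ : ℝ, 0 < CMV.speed f (z k) - CMV.speed f (z (k + 1)) ∧
        CMV.speed f (z k) - CMV.speed f (z (k + 1)) < γ ∧
        (fun t : ℝ => α t (k - 1) - (-1) ^ (k - 1) * (∏ j ∈ Finset.Icc 1 k, conj (z j)) *
          (1 + CMV.xi z μ k *
            (Real.exp (-(CMV.speed f (z k) - CMV.speed f (z (k + 1))) * t) : ℂ)))
          =O[Filter.atTop] fun t : ℝ => Real.exp (-γ * t)) ∧
      (∃ γ : ℝ, 0 < CMV.speed f (z (n - k)) - CMV.speed f (z (n - k + 1)) ∧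
        CMV.speed f (z (n - k)) - CMV.speed f (z (n - k + 1)) < γ ∧
        (fun t : ℝ => α t (k - 1) - (-1) ^ (k - 1) *
          (∏ j ∈ Finset.Icc (n - k + 1) n, conj (z j)) *
          (1 + CMV.zeta n z μ k *
            (Real.exp ((CMV.speed f (z (n - k)) - CMV.speed f (z (n - k + 1))) * t) : ℂ)))
          =O[Filter.atBot] fun t : ℝ => Real.exp (γ * t))) ∧
    -- the product formula for the asymptotic constants
    (∀ k, 1 ≤ k → k ≤ n - 1 →
      CMV.xi z μ k * CMV.zeta n z μ (n - k) =
        ((‖z (k + 1) - z k‖ ^ 2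
          * (∏ l ∈ Finset.Icc 1 (k - 1), ‖(z (k + 1) - z l) / (z k - z l)‖ ^ 2)
          * ∏ m ∈ Finset.Icc (k + 2) n, ‖(z k - z m) / (z (k + 1) - z m)‖ ^ 2 : ℝ) : ℂ)) ∧
    -- `αp m = α_{m-1}(+∞)` and `αm m = α_{m-1}(-∞)`
    (∃ αp αm : ℕ → ℂ,
      (∀ m, m ≤ n → Filter.Tendsto (fun t => CMV.shifted (α t) m) Filter.atTop (𝓝 (αp m))) ∧
      (∀ m, m ≤ n → Filter.Tendsto (fun t => CMV.shifted (α t) m) Filter.atBot (𝓝 (αm m))) ∧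
      (∀ k, 1 ≤ k → k ≤ n - 1 →
        αp k * αm (n - k) = (-1) ^ n * ∏ j ∈ Finset.Icc 1 n, conj (z j) ∧
        (∀ t, αp k * αm (n - k) = (-1) ^ n * ((CMV.cmv n (α t))ᴴ).det) ∧
        (∀ t, αp k * αm (n - k) = -α t (n - 1))) ∧
      (∀ j, 1 ≤ j → j ≤ n →
        αp j ≠ 0 ∧ z j = -(αp (j - 1) / αp j) ∧
        αm (n - j + 1) ≠ 0 ∧ z j = -(αm (n - j) / αm (n - j + 1)))) := by
  have h : CMV.IsOrderedSolution n f α z μ := ⟨hn, hα, hflow, hz, hlam, hμ⟩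
  refine ⟨h.spectrum_eq, fun k hk hkn => ⟨h.asymptotics_atTop hk hkn, h.asymptotics_atBot hk hkn⟩,
    fun k hk hkn => h.xi_mul_zeta hk hkn, fun m => CMV.verblunskyLimit z (Finset.Icc 1 m),
    fun m => CMV.verblunskyLimit z (Finset.Icc (n - m + 1) n), fun m hm => h.tendsto_atTop hm,
    fun m hm => h.tendsto_atBot hm, fun k _ hkn => ?_, fun j hj hjn => ?_⟩
  · have hkn' : k ≤ n := by omega
    exact ⟨h.limit_mul_limit_eq_prod hkn', h.limit_mul_limit_eq_det hkn',
      h.limit_mul_limit_eq_neg_last hkn'⟩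
  · obtain ⟨htop, hztop⟩ := h.eigenvalue_eq_atTop hj hjn
    obtain ⟨hbot, hzbot⟩ := h.eigenvalue_eq_atBot hj hjn
    exact ⟨htop, hztop, hbot, hzbot⟩
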